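/- Fix $c\in(1,2)$. Let $|x|_c=(|x_1|^c+|x_2|^c+|x_3|^c)^{1/c}$ on $\mathbb R^3$ and $\mathbb S_c^2=\{x\in\mathbb R^3:|x|_c=1\}$, and let $\mu_c$ be the unique Borel measure on $\mathbb S_c^2$ such that $$\int_{\mathbb R^3} g(x)\,dx=\int_0^\infty r^2\int_{\mathbb S_c^2}g(ry)\,d\mu_c(y)\,dr$$ for all Borel $g\ge 0$; explicitly, $\mu_c(A)$ is $3$ times the Lebesgue measure of $\{ry: y\in A,\ 0<r<1\}$. Write $e(t)=e^{2\pi i t}$, let $|\xi|$ be the Euclidean norm, and put $\mathcal F\mu_c(\xi)=\int_{\mathbb S_c^2}e(-w\cdot\xi)\,d\mu_c(w)$. (i) Let $f:\mathbb R^3\to\mathbb C$ be continuous on $\mathbb R^3$ and $C^\infty$ on $(\mathbb R\setminus\{0\})^3$, and suppose that for every multi-index $\beta\in\mathbb N^3$ (with $0\in\mathbb N$) there is a constant $A_\beta$ such that $$|\partial^\beta f(x)|\le A_\beta\prod_{j=1}^3|x_j|^{-\beta_j+(c-1)\mathbf 1_{\beta_j\ge 1}},\qquad x\in(\mathbb R\setminus\{0\})^3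 .$$ Then $$\Big|\int_{\mathbb S_c^2}f(w)\,e(-w\cdot\xi)\,d\mu_c(w)\Big|\le C\,(1+|\xi|)^{-1},\qquad \xi\in\mathbb R^3,$$ with a constant $C$ that depends only on $c$ and on the family $(A_\beta)_{\beta\in\mathbb N^3}$. (ii) The function $\mathcal F\mu_c$ is differentiable on $\mathbb R^3$, and there is a constant $C'$ depending only on $c$ such that $$|\mathcal F\mu_c(\xi)|+|\nabla\mathcal F\mu_c(\xi)|\le C'\,(1+|\xi|)^{-1},\qquad \xi\in\mathbb R^3 .$$ -/

import Mathlib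

open MeasureTheory
open scoped ENNReal ContDiff

/-- The norm `|x|_c = (|x₁|^c + |x₂|^c + |x₃|^c)^{1/c}` on `ℝ³`. -/
noncomputable def cNorm (c : ℝ) (x : EuclideanSpace ℝ (Fin 3)) : ℝ :=
  (∑ j, |x j| ^ c) ^ (1 / c)

/-- The `c`-sphere `{x ∈ ℝ³ : |x|_c = 1}`. -/
def cSphere (c : ℝ) : Set (EuclideanSpace ℝ (Fin 3)) :=
  {x | cNorm c x = 1}

/-- The Borel measure `μ_c` of polar coordinates with respect to `|·|_c`, as a measure on `ℝ³`
carried by the `c`-sphere: the set `A` has measure `3` times the Lebesgue volume of the cone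
`{x : 0 < |x|_c < 1, x / |x|_c ∈ A}`. Below, `cSphereMeasure_compl_cSphere` shows that it is carried
by the `c`-sphere and `lintegral_polar_cSphereMeasure` that it satisfies the polar coordinates
formula `∫ f(x) dx = ∫_0^∞ r² ∫ f(r y) dμ_c(y) dr`, which determines it. -/
noncomputable def cSphereMeasure (c : ℝ) : Measure (EuclideanSpace ℝ (Fin 3)) :=
  (3 : ℝ≥0∞) • (volume.restrict {x | 0 < cNorm c x ∧ cNorm c x < 1}).map
    (fun x => (cNorm c x)⁻¹ • x)

lemma measurable_cNorm (c : ℝ) : Measurable (cNorm c) := by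
  unfold cNorm
  fun_prop

lemma cNorm_nonneg (c : ℝ) (x : EuclideanSpace ℝ (Fin 3)) : 0 ≤ cNorm c x := by
  unfold cNorm; positivity

lemma cNorm_smul {c : ℝ} (hc : 0 < c) {t : ℝ} (ht : 0 ≤ t) (x : EuclideanSpace ℝ (Fin 3)) :
    cNorm c (t • x) = t * cNorm c x := by
  unfold cNorm
  have h : ∀ j, |(t • x) j| ^ c = t ^ c * |x j| ^ c := fun j => by
    rw [PiLp.smul_apply, smul_eq_mul, abs_mul, abs_of_nonneg ht,
      Real.mul_rpow ht (abs_nonneg _)]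
  simp_rw [h]
  rw [← Finset.mul_sum, Real.mul_rpow (by positivity) (by positivity), ← Real.rpow_mul ht,
    mul_one_div_cancel hc.ne', Real.rpow_one]

lemma cNorm_pos {c : ℝ} {x : EuclideanSpace ℝ (Fin 3)} (hx : x ≠ 0) :
    0 < cNorm c x := by
  unfold cNorm
  obtain ⟨j, hj⟩ : ∃ j, x j ≠ 0 := by
    by_contra! h
    exact hx (by ext j; simpa using h j)
  have : 0 < ∑ j, |x j| ^ c :=
    Finset.sum_pos' (fun i _ => by positivity) ⟨j, Finset.mem_univ _, by positivity⟩
  positivity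

lemma lintegral_cSphereMeasure (c : ℝ) {g : EuclideanSpace ℝ (Fin 3) → ℝ≥0∞} (hg : Measurable g) :
    ∫⁻ y, g y ∂(cSphereMeasure c) =
      3 * ∫⁻ x in {x | 0 < cNorm c x ∧ cNorm c x < 1}, g ((cNorm c x)⁻¹ • x) := by
  have := measurable_cNorm c
  rw [cSphereMeasure, lintegral_smul_measure, lintegral_map hg (by fun_prop), smul_eq_mul]

lemma cSphereMeasure_compl_cSphere {c : ℝ} (hc : 0 < c) :
    cSphereMeasure c (cSphere c)ᶜ = 0 := by
  have hm := measurable_cNorm c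
  have hs : MeasurableSet (cSphere c)ᶜ := (hm (measurableSet_singleton 1)).compl
  rw [cSphereMeasure, Measure.smul_apply, Measure.map_apply (by fun_prop) hs,
    Measure.restrict_apply ((by fun_prop : Measurable fun x => (cNorm c x)⁻¹ • x) hs)]
  convert smul_zero _
  convert measure_empty (μ := volume)
  ext x
  simp only [cSphere, Set.mem_inter_iff, Set.mem_preimage, Set.mem_compl_iff, Set.mem_ofPred_eq,
    Set.mem_empty_iff_false, iff_false]
  rintro ⟨h, h0 : 0 < cNorm c x, -⟩
  exact h (by rw [cNorm_smul hc (by positivity), inv_mul_cancel₀ h0.ne'])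

lemma lintegral_Ioi_zero_comp_mul {a : ℝ} (ha : 0 < a) (g : ℝ → ℝ≥0∞) :
    ∫⁻ r in Set.Ioi (0 : ℝ), g r = ENNReal.ofReal a * ∫⁻ s in Set.Ioi (0 : ℝ), g (s * a) := by
  have h := lintegral_image_eq_lintegral_abs_deriv_mul (s := Set.Ioi (0 : ℝ))
    (f := fun s => s * a) (f' := fun _ => a) measurableSet_Ioi
    (fun x _ => by simpa using ((hasDerivAt_id x).mul_const a).hasDerivWithinAt)
    (fun x _ y _ hxy => mul_right_cancel₀ ha.ne' hxy) g
  have himg : (fun s => s * a) '' Set.Ioi (0 : ℝ) = Set.Ioi 0 := by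
    ext y
    refine ⟨?_, fun hy => ⟨y / a, div_pos hy ha, div_mul_cancel₀ _ ha.ne'⟩⟩
    rintro ⟨x, hx, rfl⟩
    exact mul_pos hx ha
  rw [himg] at h
  rw [h, abs_of_pos ha, lintegral_const_mul' _ _ ENNReal.ofReal_ne_top]

lemma lintegral_smul_eq {s : ℝ} (hs : 0 < s) (g : EuclideanSpace ℝ (Fin 3) → ℝ≥0∞) :
    ∫⁻ x, g (s • x) = ENNReal.ofReal (s ^ 3)⁻¹ * ∫⁻ y, g y := by
  have h := Measure.map_addHaar_smul (volume : Measure (EuclideanSpace ℝ (Fin 3))) hs.ne'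
  rw [finrank_euclideanSpace_fin, abs_of_pos (by positivity)] at h
  rw [← smul_eq_mul, ← lintegral_smul_measure, ← h]
  exact (lintegral_map_equiv g (Homeomorph.smulOfNeZero s hs.ne').toMeasurableEquiv).symm

lemma lintegral_Ioi_inv_pow_four {a : ℝ} (ha : 0 < a) :
    ∫⁻ s in Set.Ioi a, ENNReal.ofReal (s ^ 4)⁻¹ = ENNReal.ofReal (1 / (3 * a ^ 3)) := by
  have h1 : ∀ s ∈ Set.Ioi a, (s ^ 4)⁻¹ = s ^ (-4 : ℝ) := fun s hs => by
    rw [Real.rpow_neg (ha.trans hs).le]; norm_cast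
  have hi := integrableOn_Ioi_rpow_of_lt (a := -4) (by norm_num) ha
  rw [setLIntegral_congr_fun measurableSet_Ioi (fun s hs => by rw [h1 s hs]),
    ← ofReal_integral_eq_lintegral_ofReal hi ?_, integral_Ioi_rpow_of_lt (by norm_num) ha]
  · congr 1
    have : a ^ ((-4 : ℝ) + 1) = (a ^ 3)⁻¹ := by
      rw [show (-4 : ℝ) + 1 = -(3 : ℕ) by norm_num, Real.rpow_neg ha.le, Real.rpow_natCast]
    rw [this]; field_simp; norm_num
  · filter_upwards [ae_restrict_mem measurableSet_Ioi] with s hs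
    exact Real.rpow_nonneg (ha.trans hs).le _

/-- The polar coordinates formula that characterizes `μ_c`. -/
theorem lintegral_polar_cSphereMeasure {c : ℝ} (hc : 0 < c)
    {f : EuclideanSpace ℝ (Fin 3) → ℝ≥0∞} (hf : Measurable f) :
    ∫⁻ x, f x = ∫⁻ r in Set.Ioi (0 : ℝ),
      ENNReal.ofReal (r ^ 2) * ∫⁻ y, f (r • y) ∂(cSphereMeasure c) := by
  have hm := measurable_cNorm c
  set B : Set (EuclideanSpace ℝ (Fin 3)) := {x | 0 < cNorm c x ∧ cNorm c x < 1} with hB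
  have hBm : MeasurableSet B :=
    (measurableSet_lt measurable_const hm).inter (measurableSet_lt hm measurable_const)
  symm
  calc ∫⁻ r in Set.Ioi (0 : ℝ), ENNReal.ofReal (r ^ 2) * ∫⁻ y, f (r • y) ∂(cSphereMeasure c)
      = ∫⁻ r in Set.Ioi (0 : ℝ), ∫⁻ x in B,
          3 * (ENNReal.ofReal (r ^ 2) * f (r • (cNorm c x)⁻¹ • x)) := by
        refine lintegral_congr fun r => ?_
        rw [lintegral_cSphereMeasure c (by fun_prop), lintegral_const_mul _ (by fun_prop),
          lintegral_const_mul _ (by fun_prop)]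
        ring
    _ = ∫⁻ x in B, ∫⁻ r in Set.Ioi (0 : ℝ),
          3 * (ENNReal.ofReal (r ^ 2) * f (r • (cNorm c x)⁻¹ • x)) :=
        lintegral_lintegral_swap (by fun_prop)
    _ = ∫⁻ x in B, ∫⁻ s in Set.Ioi (0 : ℝ),
          3 * (ENNReal.ofReal (s ^ 2 * cNorm c x ^ 3) * f (s • x)) := by
        refine setLIntegral_congr_fun hBm fun x hx => ?_
        rw [lintegral_Ioi_zero_comp_mul hx.1, ← lintegral_const_mul _ (by fun_prop)]
        refine lintegral_congr fun s => ?_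
        rw [smul_smul, mul_assoc s, mul_inv_cancel₀ hx.1.ne', mul_one, mul_left_comm,
          ← mul_assoc (ENNReal.ofReal (cNorm c x)), ← ENNReal.ofReal_mul hx.1.le]
        ring_nf
    _ = ∫⁻ s in Set.Ioi (0 : ℝ), ∫⁻ x in B,
          3 * (ENNReal.ofReal (s ^ 2 * cNorm c x ^ 3) * f (s • x)) :=
        lintegral_lintegral_swap (by fun_prop)
    _ = ∫⁻ s in Set.Ioi (0 : ℝ), ∫⁻ y, {p : ℝ × EuclideanSpace ℝ (Fin 3) |
          0 < cNorm c p.2 ∧ cNorm c p.2 < p.1}.indicator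
          (fun p => 3 * (ENNReal.ofReal ((p.1 ^ 4)⁻¹ * cNorm c p.2 ^ 3) * f p.2)) (s, y) := by
        refine setLIntegral_congr_fun measurableSet_Ioi fun s hs => ?_
        have hs : (0 : ℝ) < s := hs
        rw [← lintegral_indicator hBm]
        have := lintegral_smul_eq hs (fun y => ENNReal.ofReal (s ^ 3) *
          {p : ℝ × EuclideanSpace ℝ (Fin 3) | 0 < cNorm c p.2 ∧ cNorm c p.2 < p.1}.indicator
          (fun p => 3 * (ENNReal.ofReal ((p.1 ^ 4)⁻¹ * cNorm c p.2 ^ 3) * f p.2)) (s, y))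
        rw [lintegral_const_mul' _ _ ENNReal.ofReal_ne_top, lintegral_const_mul' _ _
          ENNReal.ofReal_ne_top, ← mul_assoc, ← ENNReal.ofReal_mul (by positivity),
          inv_mul_cancel₀ (by positivity), ENNReal.ofReal_one, one_mul] at this
        rw [← this, ← lintegral_const_mul' _ _ ENNReal.ofReal_ne_top]
        refine lintegral_congr fun x => ?_
        simp only [Set.indicator, hB, Set.mem_ofPred_eq, cNorm_smul hc hs.le,
          mul_pos_iff_of_pos_left hs, mul_lt_iff_lt_one_right hs]
        split_ifs with h
        · rw [mul_left_comm (ENNReal.ofReal (s ^ 3)) 3, ← mul_assoc (ENNReal.ofReal (s ^ 3)),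
            ← ENNReal.ofReal_mul (by positivity)]
          congr 3
          field_simp
        · simp
    _ = ∫⁻ y, ∫⁻ s in Set.Ioi (0 : ℝ), {p : ℝ × EuclideanSpace ℝ (Fin 3) |
          0 < cNorm c p.2 ∧ cNorm c p.2 < p.1}.indicator
          (fun p => 3 * (ENNReal.ofReal ((p.1 ^ 4)⁻¹ * cNorm c p.2 ^ 3) * f p.2)) (s, y) := by
        refine lintegral_lintegral_swap (Measurable.aemeasurable ?_)
        refine Measurable.indicator (f := fun p : ℝ × EuclideanSpace ℝ (Fin 3) =>
          3 * (ENNReal.ofReal ((p.1 ^ 4)⁻¹ * cNorm c p.2 ^ 3) * f p.2)) (by fun_prop) ?_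
        have hm2 : Measurable fun p : ℝ × EuclideanSpace ℝ (Fin 3) => cNorm c p.2 := by fun_prop
        exact (measurableSet_lt measurable_const hm2).inter (measurableSet_lt hm2 measurable_fst)
    _ = ∫⁻ y, f y := by
        refine lintegral_congr_ae ?_
        filter_upwards [compl_mem_ae_iff.2 (measure_singleton (μ := volume)
          (0 : EuclideanSpace ℝ (Fin 3)))] with y hy
        have hy : 0 < cNorm c y := cNorm_pos hy
        have : ∀ s : ℝ, {p : ℝ × EuclideanSpace ℝ (Fin 3) |
            0 < cNorm c p.2 ∧ cNorm c p.2 < p.1}.indicator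
            (fun p => 3 * (ENNReal.ofReal ((p.1 ^ 4)⁻¹ * cNorm c p.2 ^ 3) * f p.2)) (s, y) =
            (Set.Ioi (cNorm c y)).indicator (fun s => (3 * ENNReal.ofReal (cNorm c y ^ 3) * f y) *
              ENNReal.ofReal (s ^ 4)⁻¹) s := fun s => by
          simp only [Set.indicator, Set.mem_ofPred_eq, Set.mem_Ioi, hy, true_and]
          split_ifs
          · rw [ENNReal.ofReal_mul (by positivity)]; ring
          · rfl
        simp_rw [this]
        rw [setLIntegral_indicator measurableSet_Ioi,
          Set.inter_eq_left.2 (Set.Ioi_subset_Ioi hy.le), lintegral_const_mul _ (by fun_prop),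
          lintegral_Ioi_inv_pow_four hy, mul_right_comm, ← ENNReal.ofReal_ofNat,
          ← ENNReal.ofReal_mul (by positivity), ← ENNReal.ofReal_mul (by positivity)]
        rw [show (OfNat.ofNat 3 : ℝ) * cNorm c y ^ 3 * (1 / (3 * cNorm c y ^ 3)) = 1 by
          field_simp, ENNReal.ofReal_one, one_mul]

/-- `e(t) = exp(2πit)`. -/
noncomputable def expTwoPiI (t : ℝ) : ℂ :=
  Complex.exp (2 * Real.pi * Complex.I * t)

/-- The partial derivative `∂_j g`. -/
noncomputable def partialDeriv (j : Fin 3) (g : EuclideanSpace ℝ (Fin 3) → ℂ) :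
    EuclideanSpace ℝ (Fin 3) → ℂ :=
  fun x => lineDeriv ℝ g x (EuclideanSpace.single j 1)

/-- The partial derivative `∂^β g = ∂_1^{β_1} ∂_2^{β_2} ∂_3^{β_3} g` (coordinates are numbered
from `0` in the code). -/
noncomputable def multiDeriv (β : Fin 3 → ℕ) (g : EuclideanSpace ℝ (Fin 3) → ℂ) :
    EuclideanSpace ℝ (Fin 3) → ℂ :=
  (partialDeriv 0)^[β 0] ((partialDeriv 1)^[β 1] ((partialDeriv 2)^[β 2] g))

/-- The gradient `∇g = (∂_1 g, ∂_2 g, ∂_3 g)` with values in `ℂ³` with its Hermitian norm. -/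
noncomputable def complexGradient (g : EuclideanSpace ℝ (Fin 3) → ℂ)
    (x : EuclideanSpace ℝ (Fin 3)) : EuclideanSpace ℂ (Fin 3) :=
  WithLp.toLp 2 fun j => partialDeriv j g x

/-- The Fourier transform `ξ ↦ ∫ e(-w·ξ) dμ_c(w)` of `μ_c`. -/
noncomputable def cSphereFourier (c : ℝ) (ξ : EuclideanSpace ℝ (Fin 3)) : ℂ :=
  ∫ w, expTwoPiI (-inner ℝ w ξ) ∂(cSphereMeasure c)

/-- The set `(ℝ \ {0})³`. -/
def offCoordinatePlanes : Set (EuclideanSpace ℝ (Fin 3)) :=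
  {x | ∀ j, x j ≠ 0}

/-! Up to a null set, the sphere splits into 24 pieces according to the signs of the coordinates and
to which coordinate is largest in modulus. Signed transpositions, which preserve both norms, reduce
everything to the piece where all coordinates are positive and the third is largest. There the
sphere is the graph of h = u^(1/c), u = 1 - x^c - y^c ≥ 1/3, and μ_c has density u^(1/c-1)
(`setIntegral_chartCone`). What remains is a planar oscillatory integral with phase l₁x + l₂y - σh.
The second derivatives of h blow up like x^(c-2) and y^(c-2) at the axes, so the usual stationary
phase argument is not available; convexity and monotonicity take its place.

Suppose first that the third frequency is comparable to the largest one. Replacing the phase by its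
negative if necessary, σ > 0 and the phase is convex. Polar coordinates are taken about a minimum
point over the closed region, which may lie on the boundary. On every ray the slope ψ' is
nonnegative at r = 0 and at least σ(c-1)r, so the Jacobian factor r makes r/ψ' at most 1/(σ(c-1)).
One integration by parts then gives O(1/σ) uniformly in the direction, once r/ψ' is known to have
total variation O(1/σ). That is the main point: the increments of first derivatives along the ray
are r times chords of the concave function z^(c-1). Such chords are monotone in r, so their
reciprocals, shifted by a positive constant, have bounded variation however singular the second
derivatives are (`ChartLine.abs_slope_sub_le`, `ChartLine.norm_integral_ray_le`).

Otherwise a horizontal frequency is at least twice the third one in modulus. Since the graph has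
slopes at most 1 in each coordinate direction, the phase has no critical point along that direction,
and one integration by parts on each coordinate line suffices
(`ChartLine.norm_integral_transversal_le`).

The amplitude enters only through its size and its first derivatives, which are bounded by the
powers x^(c-2) and y^(c-2), integrable because c > 1. Part (ii) is the same estimate for f = 1 and
for f = -2πi w_j. -/

open Set Filter Topology

local notation "E3" => EuclideanSpace ℝ (Fin 3)

/-! ### Integration by parts for an oscillating integrand -/

/-- First derivative test: if `φ = B ψ' e^{isψ}` with `|s| = 1` and `‖B'‖ ≤ V'`, then the integral of
`φ` is controlled by the boundary values of `B` and the increment of `V`. -/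
theorem norm_integral_le_of_oscillating {a b s : ℝ} (hab : a ≤ b) (hs : |s| = 1)
    {φ B B' : ℝ → ℂ} {ψ ψ' V V' : ℝ → ℝ} (hφ : ContinuousOn φ (Icc a b))
    (hB : ∀ r ∈ Icc a b, HasDerivAt B (B' r) r) (hψ : ∀ r ∈ Icc a b, HasDerivAt ψ (ψ' r) r)
    (hV : ∀ r ∈ Icc a b, HasDerivAt V (V' r) r) (hle : ∀ r ∈ Icc a b, ‖B' r‖ ≤ V' r)
    (hφB : ∀ r ∈ Icc a b, φ r = B r * ψ' r * Complex.exp (Complex.I * (s * ψ r))) :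
    ‖∫ r in a..b, φ r‖ ≤ ‖B a‖ + ‖B b‖ + (V b - V a) := by
  have hs0 : s ≠ 0 := by rintro rfl; simp at hs
  have hIs : ‖(Complex.I * (s : ℂ))⁻¹‖ = 1 := by
    rw [norm_inv, norm_mul, Complex.norm_I, Complex.norm_real, Real.norm_eq_abs, hs]; norm_num
  have hIs0 : Complex.I * (s : ℂ) ≠ 0 := by simp [hs0]
  -- The constant extension beyond a and b is continuous on the whole line, so its primitive is
  -- differentiable at the end points as well.
  set φt : ℝ → ℂ := IccExtend hab ((Icc a b).domRestrict φ) with hφt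
  have hφc : Continuous φt := (continuousOn_iff_continuous_domRestrict.1 hφ).Icc_extend'
  have hφe : ∀ r ∈ Icc a b, φt r = φ r := fun r hr => by
    rw [hφt, IccExtend_of_mem hab _ hr]; rfl
  have hint : ∫ r in a..b, φ r = ∫ r in a..b, φt r := by
    refine intervalIntegral.integral_congr fun r hr => ?_
    rw [uIcc_of_le hab] at hr
    exact (hφe r hr).symm
  set E : ℝ → ℂ := fun r => Complex.exp (Complex.I * (s * ψ r)) with hE
  have hEn : ∀ r, ‖E r‖ = 1 := fun r => by
    have := Complex.norm_exp_ofReal_mul_I (s * ψ r)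
    rw [hE]; simp only
    rw [mul_comm Complex.I]; exact_mod_cast this
  have hEd : ∀ r ∈ Icc a b, HasDerivAt E (E r * (Complex.I * (s * ψ' r))) r := fun r hr =>
    (((hψ r hr).ofReal_comp.const_mul (s : ℂ)).const_mul Complex.I).cexp
  set H : ℝ → ℂ := fun r => (B r * E r * (Complex.I * s)⁻¹ - B a * E a * (Complex.I * s)⁻¹)
    - ∫ t in a..r, φt t with hH
  have hHd : ∀ r ∈ Icc a b, HasDerivAt H (B' r * E r * (Complex.I * s)⁻¹) r := fun r hr => by
    have h := ((((hB r hr).mul (hEd r hr)).mul_const (Complex.I * (s : ℂ))⁻¹).sub_const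
      (B a * E a * (Complex.I * s)⁻¹)).sub (hφc.integral_hasStrictDerivAt a r).hasDerivAt
    refine h.congr_deriv ?_
    rw [hφe r hr, hφB r hr]
    change _ - B r * ψ' r * E r = _
    calc _ = B' r * E r * (Complex.I * s)⁻¹ +
          B r * ψ' r * E r * ((Complex.I * s) * (Complex.I * s)⁻¹) - B r * ψ' r * E r := by ring
      _ = _ := by rw [mul_inv_cancel₀ hIs0]; ring
  -- `H` is the remainder of the integration by parts. The mean value inequality bounds it through
  -- `V` without asking that `B'` be integrable or even measurable.
  have key : ‖H b‖ ≤ V b - V a := by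
    refine image_norm_le_of_norm_deriv_right_le_deriv_boundary' (f := H) (a := a) (b := b)
      (f' := fun r => B' r * E r * (Complex.I * s)⁻¹) (B := fun r => V r - V a) (B' := V')
      (fun r hr => (hHd r hr).continuousAt.continuousWithinAt)
      (fun r hr => (hHd r (Ico_subset_Icc_self hr)).hasDerivWithinAt) ?_
      (fun r hr => ((hV r hr).sub_const _).continuousAt.continuousWithinAt)
      (fun r hr => ((hV r (Ico_subset_Icc_self hr)).sub_const _).hasDerivWithinAt)
      (fun r hr => ?_) (right_mem_Icc.2 hab)
    · simp [hH]
    · rw [norm_mul, norm_mul, hEn, hIs, mul_one, mul_one]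
      exact hle r (Ico_subset_Icc_self hr)
  have hsplit : ∫ r in a..b, φ r =
      (B b * E b * (Complex.I * s)⁻¹ - B a * E a * (Complex.I * s)⁻¹) - H b := by
    rw [hint, hH]; ring
  have n1 : ∀ r, ‖B r * E r * (Complex.I * s)⁻¹‖ = ‖B r‖ := fun r => by
    rw [norm_mul, norm_mul, hEn, hIs, mul_one, mul_one]
  calc ‖∫ r in a..b, φ r‖ ≤ ‖B b‖ + ‖B a‖ + ‖H b‖ := by
        rw [hsplit]
        refine (norm_sub_le _ _).trans ?_
        gcongr
        refine (norm_sub_le _ _).trans ?_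
        rw [n1, n1]
    _ ≤ _ := by linarith

/-! ### The graph along a line: height, density and their derivatives -/

/-- A segment `r ↦ (x + r s, y + r t)`, `0 ≤ r ≤ R`, in the domain of the graph
`(1 - x ^ c - y ^ c) ^ (1 / c)` over which the third coordinate of the `c`-sphere is the largest. -/
structure ChartLine (c : ℝ) where
  x : ℝ
  y : ℝ
  s : ℝ
  t : ℝ
  R : ℝ
  one_lt : 1 < c
  lt_two : c < 2
  R_pos : 0 < R
  R_le : R ≤ 2
  x_nonneg : 0 ≤ x
  y_nonneg : 0 ≤ y
  abs_s_le : |s| ≤ 1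
  abs_t_le : |t| ≤ 1
  -- Positivity is required only for r > 0, so that a line may start on a coordinate axis. There `P`
  -- need not be differentiable, which is why later derivatives are taken on `Ioc 0 L.R`.
  fst_pos : ∀ r ∈ Ioc 0 R, 0 < x + r * s
  snd_pos : ∀ r ∈ Ioc 0 R, 0 < y + r * t
  fst_le : ∀ r ∈ Icc 0 R, 2 * (x + r * s) ^ c + (y + r * t) ^ c ≤ 1
  snd_le : ∀ r ∈ Icc 0 R, (x + r * s) ^ c + 2 * (y + r * t) ^ c ≤ 1

namespace ChartLine

variable {c : ℝ} (L : ChartLine c)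

noncomputable def u (r : ℝ) : ℝ := 1 - (L.x + r * L.s) ^ c - (L.y + r * L.t) ^ c

/-- The height of the graph. -/
noncomputable def h (r : ℝ) : ℝ := L.u r ^ (1 / c)

/-- The density of the cone measure in the chart. -/
noncomputable def m (r : ℝ) : ℝ := L.u r ^ (1 / c - 1)

/-- The derivative of `h` is -m P, and that of `P` is (c-1) q. The singular but integrable `Q` is
the yardstick for derivatives of amplitudes. -/
noncomputable def P (r : ℝ) : ℝ :=
  L.s * (L.x + r * L.s) ^ (c - 1) + L.t * (L.y + r * L.t) ^ (c - 1)

noncomputable def q (r : ℝ) : ℝ :=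
  L.s ^ 2 * (L.x + r * L.s) ^ (c - 2) + L.t ^ 2 * (L.y + r * L.t) ^ (c - 2)

noncomputable def Q (r : ℝ) : ℝ :=
  |L.s| * (L.x + r * L.s) ^ (c - 2) + |L.t| * (L.y + r * L.t) ^ (c - 2)

lemma fst_nonneg {r : ℝ} (hr : r ∈ Icc 0 L.R) : 0 ≤ L.x + r * L.s := by
  rcases hr.1.eq_or_lt with rfl | h
  · simpa using L.x_nonneg
  · exact (L.fst_pos r ⟨h, hr.2⟩).le

lemma snd_nonneg {r : ℝ} (hr : r ∈ Icc 0 L.R) : 0 ≤ L.y + r * L.t := by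
  rcases hr.1.eq_or_lt with rfl | h
  · simpa using L.y_nonneg
  · exact (L.snd_pos r ⟨h, hr.2⟩).le

lemma c_pos (L : ChartLine c) : 0 < c := by linarith [L.one_lt]

lemma fst_le_one {r : ℝ} (hr : r ∈ Icc 0 L.R) : L.x + r * L.s ≤ 1 := by
  have h1 := L.fst_nonneg hr
  have h2 := L.snd_nonneg hr
  by_contra! h
  have := Real.one_lt_rpow h L.c_pos
  have := L.fst_le r hr
  have := Real.rpow_nonneg h2 c
  linarith

lemma snd_le_one {r : ℝ} (hr : r ∈ Icc 0 L.R) : L.y + r * L.t ≤ 1 := by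
  have h1 := L.fst_nonneg hr
  have h2 := L.snd_nonneg hr
  by_contra! h
  have := Real.one_lt_rpow h L.c_pos
  have := L.snd_le r hr
  have := Real.rpow_nonneg h1 c
  linarith

/-- Adding the two constraints of the region gives x^c + y^c ≤ 2/3. -/
lemma third_le_u {r : ℝ} (hr : r ∈ Icc 0 L.R) : 1 / 3 ≤ L.u r := by
  have := L.fst_le r hr
  have := L.snd_le r hr
  unfold u; linarith

lemma u_pos {r : ℝ} (hr : r ∈ Icc 0 L.R) : 0 < L.u r := by linarith [L.third_le_u hr]

lemma u_le_one {r : ℝ} (hr : r ∈ Icc 0 L.R) : L.u r ≤ 1 := by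
  have := Real.rpow_nonneg (L.fst_nonneg hr) c
  have := Real.rpow_nonneg (L.snd_nonneg hr) c
  unfold u; linarith

/-- Negative powers of `u`. -/
lemma one_le_u_rpow {r : ℝ} (hr : r ∈ Icc 0 L.R) {e : ℝ} (he : e ≤ 0) : 1 ≤ L.u r ^ e :=
  Real.one_le_rpow_of_pos_of_le_one_of_nonpos (L.u_pos hr) (L.u_le_one hr) he

lemma u_rpow_le {r : ℝ} (hr : r ∈ Icc 0 L.R) {e : ℝ} {n : ℕ} (he : -(n : ℝ) ≤ e) :
    L.u r ^ e ≤ 3 ^ n := by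
  calc L.u r ^ e ≤ L.u r ^ (-(n : ℝ)) :=
        Real.rpow_le_rpow_of_exponent_ge (L.u_pos hr) (L.u_le_one hr) he
    _ = (L.u r)⁻¹ ^ n := by
        rw [Real.rpow_neg (L.u_pos hr).le, Real.rpow_natCast, inv_pow]
    _ ≤ 3 ^ n := by
        have := L.u_pos hr
        gcongr
        rw [inv_le_comm₀ (L.u_pos hr) (by norm_num)]
        have := L.third_le_u hr
        linarith

lemma inv_c_bounds (L : ChartLine c) : 1 / 2 < 1 / c ∧ 1 / c < 1 := by
  have h1 := L.one_lt
  have h2 := L.lt_two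
  constructor
  · exact one_div_lt_one_div_of_lt L.c_pos h2
  · rw [div_lt_one L.c_pos]; exact h1

lemma one_le_m {r : ℝ} (hr : r ∈ Icc 0 L.R) : 1 ≤ L.m r :=
  L.one_le_u_rpow hr (by linarith [L.inv_c_bounds.2])

lemma m_le {r : ℝ} (hr : r ∈ Icc 0 L.R) : L.m r ≤ 3 := by
  have := L.u_rpow_le hr (e := 1 / c - 1) (n := 1) (by push_cast; linarith [L.inv_c_bounds.1])
  rwa [pow_one] at this

lemma hasDerivAt_fst (r : ℝ) : HasDerivAt (fun r => L.x + r * L.s) L.s r := by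
  simpa using ((hasDerivAt_id r).mul_const L.s).const_add L.x

lemma hasDerivAt_snd (r : ℝ) : HasDerivAt (fun r => L.y + r * L.t) L.t r := by
  simpa using ((hasDerivAt_id r).mul_const L.t).const_add L.y

lemma hasDerivAt_u (r : ℝ) : HasDerivAt L.u (-(c * L.P r)) r := by
  have h1 := (L.hasDerivAt_fst r).rpow_const (p := c) (Or.inr L.one_lt.le)
  have h2 := (L.hasDerivAt_snd r).rpow_const (p := c) (Or.inr L.one_lt.le)
  refine ((h1.const_sub 1).sub h2).congr_deriv ?_
  unfold P; ring

lemma hasDerivAt_u_rpow {r : ℝ} (hr : r ∈ Icc 0 L.R) (e : ℝ) :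
    HasDerivAt (fun r => L.u r ^ e) (-(c * e * L.u r ^ (e - 1) * L.P r)) r := by
  refine ((L.hasDerivAt_u r).rpow_const (p := e) (Or.inl (L.u_pos hr).ne')).congr_deriv ?_
  ring

lemma hasDerivAt_h {r : ℝ} (hr : r ∈ Icc 0 L.R) : HasDerivAt L.h (-(L.m r * L.P r)) r := by
  refine (L.hasDerivAt_u_rpow hr (1 / c)).congr_deriv ?_
  rw [mul_one_div_cancel L.c_pos.ne', one_mul, m]

lemma hasDerivAt_m {r : ℝ} (hr : r ∈ Icc 0 L.R) :
    HasDerivAt L.m ((c - 1) * L.u r ^ (1 / c - 2) * L.P r) r := by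
  refine (L.hasDerivAt_u_rpow hr (1 / c - 1)).congr_deriv ?_
  rw [show 1 / c - 1 - 1 = 1 / c - 2 by ring]
  have := L.c_pos.ne'
  field_simp
  ring

lemma hasDerivAt_P {r : ℝ} (hr : r ∈ Ioc 0 L.R) : HasDerivAt L.P ((c - 1) * L.q r) r := by
  have h1 := ((L.hasDerivAt_fst r).rpow_const (p := c - 1)
    (Or.inl (L.fst_pos r hr).ne')).const_mul L.s
  have h2 := ((L.hasDerivAt_snd r).rpow_const (p := c - 1)
    (Or.inl (L.snd_pos r hr).ne')).const_mul L.t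
  refine (h1.add h2).congr_deriv ?_
  rw [show c - 1 - 1 = c - 2 by ring]
  unfold q; ring

lemma continuous_P : Continuous L.P := by
  have h := L.one_lt
  unfold P
  have : 0 ≤ c - 1 := by linarith
  fun_prop (disch := assumption)

lemma abs_P_le {r : ℝ} (hr : r ∈ Icc 0 L.R) : |L.P r| ≤ 2 := by
  have hc : 0 ≤ c - 1 := by linarith [L.one_lt]
  have h1 := Real.rpow_le_one (L.fst_nonneg hr) (L.fst_le_one hr) hc
  have h2 := Real.rpow_le_one (L.snd_nonneg hr) (L.snd_le_one hr) hc
  have h3 := Real.rpow_nonneg (L.fst_nonneg hr) (c - 1)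
  have h4 := Real.rpow_nonneg (L.snd_nonneg hr) (c - 1)
  unfold P
  refine (abs_add_le _ _).trans ?_
  rw [abs_mul, abs_mul, abs_of_nonneg h3, abs_of_nonneg h4]
  have := mul_le_one₀ L.abs_s_le h3 h1
  have := mul_le_one₀ L.abs_t_le h4 h2
  linarith

lemma Ioc_subset_Icc {r : ℝ} (hr : r ∈ Ioc 0 L.R) : r ∈ Icc 0 L.R := ⟨hr.1.le, hr.2⟩

lemma one_le_fst_rpow {r : ℝ} (hr : r ∈ Ioc 0 L.R) : 1 ≤ (L.x + r * L.s) ^ (c - 2) :=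
  Real.one_le_rpow_of_pos_of_le_one_of_nonpos (L.fst_pos r hr)
    (L.fst_le_one (L.Ioc_subset_Icc hr)) (by linarith [L.lt_two])

lemma one_le_snd_rpow {r : ℝ} (hr : r ∈ Ioc 0 L.R) : 1 ≤ (L.y + r * L.t) ^ (c - 2) :=
  Real.one_le_rpow_of_pos_of_le_one_of_nonpos (L.snd_pos r hr)
    (L.snd_le_one (L.Ioc_subset_Icc hr)) (by linarith [L.lt_two])

lemma le_q {r : ℝ} (hr : r ∈ Ioc 0 L.R) : L.s ^ 2 + L.t ^ 2 ≤ L.q r := by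
  have h1 := L.one_le_fst_rpow hr
  have h2 := L.one_le_snd_rpow hr
  have := mul_le_mul_of_nonneg_left h1 (sq_nonneg L.s)
  have := mul_le_mul_of_nonneg_left h2 (sq_nonneg L.t)
  unfold q; linarith

lemma q_nonneg {r : ℝ} (hr : r ∈ Ioc 0 L.R) : 0 ≤ L.q r :=
  le_trans (by positivity) (L.le_q hr)

lemma abs_P_le_Q {r : ℝ} (hr : r ∈ Ioc 0 L.R) : |L.P r| ≤ L.Q r := by
  have h1 := L.fst_pos r hr
  have h2 := L.snd_pos r hr
  have h3 := L.fst_le_one (L.Ioc_subset_Icc hr)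
  have h4 := L.snd_le_one (L.Ioc_subset_Icc hr)
  unfold P Q
  refine (abs_add_le _ _).trans ?_
  rw [abs_mul, abs_mul, abs_of_nonneg (Real.rpow_nonneg h1.le _),
    abs_of_nonneg (Real.rpow_nonneg h2.le _)]
  refine add_le_add (mul_le_mul_of_nonneg_left ?_ (abs_nonneg _))
    (mul_le_mul_of_nonneg_left ?_ (abs_nonneg _))
  · exact Real.rpow_le_rpow_of_exponent_ge h1 h3 (by linarith)
  · exact Real.rpow_le_rpow_of_exponent_ge h2 h4 (by linarith)

lemma hasDerivAt_mul_P {r : ℝ} (hr : r ∈ Ioc 0 L.R) :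
    HasDerivAt (fun r => L.m r * L.P r)
      ((c - 1) * (L.u r ^ (1 / c - 2) * L.P r ^ 2 + L.m r * L.q r)) r := by
  refine ((L.hasDerivAt_m (L.Ioc_subset_Icc hr)).mul (L.hasDerivAt_P hr)).congr_deriv ?_
  ring

/-- Since m ≥ 1 and the term in P² is nonnegative, the slope -h' = mP grows at least as fast as `P`.
-/
lemma le_deriv_mul_P {r : ℝ} (hr : r ∈ Ioc 0 L.R) :
    (c - 1) * L.q r ≤ (c - 1) * (L.u r ^ (1 / c - 2) * L.P r ^ 2 + L.m r * L.q r) := by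
  have h1 := L.one_lt
  have h2 := L.one_le_m (L.Ioc_subset_Icc hr)
  have h3 := L.q_nonneg hr
  have h4 := L.u_pos (L.Ioc_subset_Icc hr)
  have h5 : 0 ≤ L.u r ^ (1 / c - 2) * L.P r ^ 2 := by positivity
  have : 0 ≤ c - 1 := by linarith
  gcongr
  nlinarith

lemma continuousOn_m : ContinuousOn L.m (Icc 0 L.R) :=
  fun _ hr => (L.hasDerivAt_m hr).continuousAt.continuousWithinAt

/-- A function whose derivative is nonnegative off the left end point. -/
lemma _root_.le_of_hasDerivAt_nonneg_Ioc {f f' : ℝ → ℝ} {a b R : ℝ} (hf : ContinuousOn f (Icc a R))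
    (hd : ∀ r ∈ Ioc a R, HasDerivAt f (f' r) r) (h0 : ∀ r ∈ Ioc a R, 0 ≤ f' r)
    {z : ℝ} (haz : a ≤ z) (hzb : z ≤ b) (hbR : b ≤ R) : f z ≤ f b := by
  have hm : MonotoneOn f (Icc a R) := by
    refine monotoneOn_of_deriv_nonneg (convex_Icc a R) hf ?_ ?_
    · rw [interior_Icc]
      exact fun r hr => (hd r (Ioo_subset_Ioc_self hr)).differentiableAt.differentiableWithinAt
    · rw [interior_Icc]
      intro r hr
      rw [(hd r (Ioo_subset_Ioc_self hr)).deriv]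
      exact h0 r (Ioo_subset_Ioc_self hr)
  exact hm ⟨haz, hzb.trans hbR⟩ ⟨haz.trans hzb, hbR⟩ hzb

/-- The slope of the phase dominates the increment of `P`. -/
lemma sub_le_mul_sub {r : ℝ} (hr : r ∈ Icc 0 L.R) :
    L.P r - L.P 0 ≤ L.m r * L.P r - L.m 0 * L.P 0 := by
  have := le_of_hasDerivAt_nonneg_Ioc (f := fun r => L.m r * L.P r - L.P r) (a := 0) (R := L.R)
    ((L.continuousOn_m.mul L.continuous_P.continuousOn).sub L.continuous_P.continuousOn)
    (fun r hr => (L.hasDerivAt_mul_P hr).sub (L.hasDerivAt_P hr))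
    (fun r hr => sub_nonneg.2 (L.le_deriv_mul_P hr)) le_rfl hr.1 hr.2
  linarith

/-- Uniform convexity: as c < 2 and the coordinates are at most 1, their powers c - 2 are at least
1, whence P' ≥ (c-1)(s² + t²). -/
lemma mul_le_P_sub {z r : ℝ} (hz : 0 ≤ z) (hzr : z ≤ r) (hr : r ≤ L.R) :
    (c - 1) * (L.s ^ 2 + L.t ^ 2) * (r - z) ≤ L.P r - L.P z := by
  have hc := L.one_lt
  have := le_of_hasDerivAt_nonneg_Ioc
    (f := fun r => L.P r - r * ((c - 1) * (L.s ^ 2 + L.t ^ 2))) (a := 0) (R := L.R)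
    (L.continuous_P.sub (by fun_prop)).continuousOn
    (fun r hr => (L.hasDerivAt_P hr).sub ((hasDerivAt_id r).mul_const _))
    (fun r hr => by
      have := L.le_q hr
      have := mul_le_mul_of_nonneg_left this (by linarith : 0 ≤ c - 1)
      linarith) hz hzr hr
  linarith

/-- The derivative of `m`. -/
noncomputable def m' (r : ℝ) : ℝ := (c - 1) * L.u r ^ (1 / c - 2) * L.P r

lemma abs_m'_le {r : ℝ} (hr : r ∈ Icc 0 L.R) : |L.m' r| ≤ 9 * |L.P r| := by
  have h1 := L.one_lt
  have h2 := L.lt_two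
  have h3 := L.u_pos hr
  have h4 := L.u_rpow_le hr (e := 1 / c - 2) (n := 2) (by push_cast; linarith [L.inv_c_bounds.1])
  unfold m'
  rw [abs_mul, abs_mul, abs_of_pos (by linarith), abs_of_pos (by positivity)]
  have : (c - 1) * L.u r ^ (1 / c - 2) ≤ 1 * 9 := by
    gcongr
    · linarith
    · exact h4.trans (by norm_num)
  nlinarith [abs_nonneg (L.P r)]

lemma hasDerivAt_m' {r : ℝ} (hr : r ∈ Ioc 0 L.R) :
    HasDerivAt L.m' ((c - 1) * ((2 * c - 1) * L.u r ^ (1 / c - 3) * L.P r ^ 2 +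
      (c - 1) * L.u r ^ (1 / c - 2) * L.q r)) r := by
  have h := ((L.hasDerivAt_u_rpow (L.Ioc_subset_Icc hr) (1 / c - 2)).mul
    (L.hasDerivAt_P hr)).const_mul (c - 1)
  have he : L.m' = fun r => (c - 1) * (L.u r ^ (1 / c - 2) * L.P r) := by
    ext r; unfold m'; ring
  rw [he]
  refine h.congr_deriv ?_
  rw [show 1 / c - 2 - 1 = 1 / c - 3 by ring]
  have := L.c_pos.ne'
  field_simp
  ring

/-- The only singular part of the second derivative of m is a multiple of q. The bounded part is
absorbed because q ≥ 1 for a unit direction; 333 = 3·27·4 + 9. -/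
lemma abs_deriv_m'_le (hst : L.s ^ 2 + L.t ^ 2 = 1) {r : ℝ} (hr : r ∈ Ioc 0 L.R) :
    |(c - 1) * ((2 * c - 1) * L.u r ^ (1 / c - 3) * L.P r ^ 2 +
      (c - 1) * L.u r ^ (1 / c - 2) * L.q r)| ≤ 333 * ((c - 1) * L.q r) := by
  have hr' := L.Ioc_subset_Icc hr
  have h1 := L.one_lt
  have h2 := L.lt_two
  have h3 := L.u_pos hr'
  have h4 := L.u_rpow_le hr' (e := 1 / c - 2) (n := 2) (by push_cast; linarith [L.inv_c_bounds.1])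
  have h5 := L.u_rpow_le hr' (e := 1 / c - 3) (n := 3) (by push_cast; linarith [L.inv_c_bounds.1])
  have h6 := L.le_q hr
  rw [hst] at h6
  have hP : L.P r ^ 2 ≤ 4 := by
    have := L.abs_P_le hr'
    nlinarith [abs_nonneg (L.P r), sq_abs (L.P r)]
  have h7 : 0 ≤ c - 1 := by linarith
  have h8 : 0 ≤ 2 * c - 1 := by linarith
  have h9 : 0 ≤ L.q r := by linarith
  rw [abs_of_nonneg (by positivity)]
  have e1 : (2 * c - 1) * L.u r ^ (1 / c - 3) * L.P r ^ 2 ≤ 3 * 3 ^ 3 * 4 := by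
    gcongr; linarith
  have e2 : (c - 1) * L.u r ^ (1 / c - 2) * L.q r ≤ 1 * 3 ^ 2 * L.q r := by
    gcongr; linarith
  have : (2 * c - 1) * L.u r ^ (1 / c - 3) * L.P r ^ 2 +
      (c - 1) * L.u r ^ (1 / c - 2) * L.q r ≤ 333 * L.q r := by linarith
  nlinarith [mul_le_mul_of_nonneg_left this h7]

lemma continuousOn_m' : ContinuousOn L.m' (Icc 0 L.R) := by
  intro r hr
  unfold m'
  exact ((continuousAt_const.mul (L.hasDerivAt_u_rpow hr _).continuousAt).mul
    L.continuous_P.continuousAt).continuousWithinAt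

/-- By the preceding bound both 333 P - m' and 333 P + m' are nondecreasing, so `P` controls the
variation of m'. -/
lemma abs_m'_sub_le (hst : L.s ^ 2 + L.t ^ 2 = 1) {z r : ℝ} (hz : 0 ≤ z) (hzr : z ≤ r)
    (hr : r ≤ L.R) : |L.m' r - L.m' z| ≤ 333 * (L.P r - L.P z) := by
  have hP := L.continuous_P.continuousOn (s := Icc 0 L.R)
  have h1 := le_of_hasDerivAt_nonneg_Ioc (f := fun r => 333 * L.P r - L.m' r) (a := 0) (R := L.R)
    ((continuousOn_const.mul hP).sub L.continuousOn_m')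
    (fun r hr => ((L.hasDerivAt_P hr).const_mul 333).sub (L.hasDerivAt_m' hr))
    (fun r hr => by linarith [(abs_le.1 (L.abs_deriv_m'_le hst hr)).2]) hz hzr hr
  have h2 := le_of_hasDerivAt_nonneg_Ioc (f := fun r => 333 * L.P r + L.m' r) (a := 0) (R := L.R)
    ((continuousOn_const.mul hP).add L.continuousOn_m')
    (fun r hr => ((L.hasDerivAt_P hr).const_mul 333).add (L.hasDerivAt_m' hr))
    (fun r hr => by linarith [(abs_le.1 (L.abs_deriv_m'_le hst hr)).1]) hz hzr hr
  rw [abs_le]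
  constructor <;> linarith

/-- The defect between the derivative of `m` and its difference quotient. -/
lemma abs_mul_m'_sub_le (hst : L.s ^ 2 + L.t ^ 2 = 1) {r : ℝ} (hr : r ∈ Ioc 0 L.R) :
    |r * L.m' r - (L.m r - L.m 0)| ≤ 333 * (r * (L.P r - L.P 0)) := by
  obtain ⟨z, hz, hzr⟩ := exists_hasDerivAt_eq_slope L.m L.m' hr.1
    (L.continuousOn_m.mono (Icc_subset_Icc_right hr.2))
    (fun z hz => L.hasDerivAt_m ⟨hz.1.le, hz.2.le.trans hr.2⟩)
  have h0 : L.m r - L.m 0 = r * L.m' z := by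
    rw [hzr, sub_zero, mul_div_cancel₀ _ hr.1.ne']
  rw [h0, ← mul_sub, abs_mul, abs_of_pos hr.1]
  have h1 := L.abs_m'_sub_le hst hz.1.le hz.2.le hr.2
  have h2 := L.mul_le_P_sub le_rfl hz.1.le (hz.2.le.trans hr.2)
  have h3 : 0 ≤ (c - 1) * (L.s ^ 2 + L.t ^ 2) * (z - 0) := by
    have := L.one_lt
    have := hz.1
    rw [hst]; nlinarith
  have := mul_le_mul_of_nonneg_left (h1.trans (b := 333 * (L.P r - L.P z))
    (c := 333 * (L.P r - L.P 0)) (by linarith)) hr.1.le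
  linarith

end ChartLine

/-! ### Chords of a concave power -/

/-- The direction-weighted difference quotient of `z ↦ z ^ p` along `x + r s`. -/
noncomputable def rpowChord (p x s r : ℝ) : ℝ := s * ((x + r * s) ^ p - x ^ p) / r

noncomputable def rpowChordDeriv (p x s r : ℝ) : ℝ :=
  s * (p * s * (x + r * s) ^ (p - 1) * r - ((x + r * s) ^ p - x ^ p)) / r ^ 2

lemma rpowChord_nonneg {p x s r : ℝ} (hp : 0 ≤ p) (hx : 0 ≤ x) (hr : 0 < r)
    (h : 0 < x + r * s) : 0 ≤ rpowChord p x s r := by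
  unfold rpowChord
  refine div_nonneg ?_ hr.le
  rcases le_total 0 s with hs | hs
  · refine mul_nonneg hs (sub_nonneg.2 (Real.rpow_le_rpow hx ?_ hp))
    nlinarith
  · refine mul_nonneg_of_nonpos_of_nonpos hs (sub_nonpos.2 (Real.rpow_le_rpow h.le ?_ hp))
    nlinarith

lemma hasDerivAt_rpowChord {p x s r : ℝ} (hr : 0 < r) (h : 0 < x + r * s) :
    HasDerivAt (rpowChord p x s) (rpowChordDeriv p x s r) r := by
  have h1 : HasDerivAt (fun r => x + r * s) s r := by
    simpa using ((hasDerivAt_id r).mul_const s).const_add x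
  have h2 := (((h1.rpow_const (p := p) (Or.inl h.ne')).sub_const (x ^ p)).const_mul s).div
    (hasDerivAt_id r) hr.ne'
  refine h2.congr_deriv ?_
  simp only [rpowChordDeriv, id]
  ring

/-- Concavity of the power, in the form of Bernoulli's inequality for the ratio x/z. -/
lemma rpow_le_tangent {p x z : ℝ} (hp : 0 ≤ p) (hp1 : p ≤ 1) (hx : 0 ≤ x) (hz : 0 < z) :
    x ^ p ≤ z ^ p + p * z ^ (p - 1) * (x - z) := by
  have h := rpow_one_add_le_one_add_mul_self (s := x / z - 1) (p := p)
    (by linarith [div_nonneg hx hz.le]) hp hp1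
  rw [add_sub_cancel, Real.div_rpow hx hz.le, div_le_iff₀ (by positivity)] at h
  refine h.trans (le_of_eq ?_)
  rw [Real.rpow_sub_one hz.ne']
  field_simp

/-- Chords of a concave function from a fixed end are monotone, so the derivative has constant sign,
opposite to that of s. This is what turns a bound on its integral into a bound on its total
variation. -/
lemma abs_rpowChordDeriv {p x s r : ℝ} (hp : 0 ≤ p) (hp1 : p ≤ 1) (hx : 0 ≤ x) (hr : 0 < r)
    (h : 0 < x + r * s) :
    |rpowChordDeriv p x s r| = -(Real.sign s * rpowChordDeriv p x s r) := by
  have ht := rpow_le_tangent hp hp1 hx h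
  have h0 : p * s * (x + r * s) ^ (p - 1) * r - ((x + r * s) ^ p - x ^ p) ≤ 0 := by
    nlinarith
  unfold rpowChordDeriv
  rcases lt_trichotomy s 0 with hs | rfl | hs
  · rw [Real.sign_of_neg hs, abs_of_nonneg]
    · ring
    · exact div_nonneg (mul_nonneg_of_nonpos_of_nonpos hs.le h0) (by positivity)
  · simp
  · rw [Real.sign_of_pos hs, abs_of_nonpos]
    · ring
    · exact div_nonpos_of_nonpos_of_nonneg (mul_nonpos_of_nonneg_of_nonpos hs.le h0) (by positivity)

lemma abs_realSign_le_one (s : ℝ) : |Real.sign s| ≤ 1 := by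
  rcases Real.sign_apply_eq s with h | h | h <;> rw [h] <;> norm_num

/-- The reciprocal of a chord is of bounded variation: an explicit primitive. -/
lemma hasDerivAt_sign_div_rpowChord {p x s r k : ℝ} (hp : 0 ≤ p) (hp1 : p ≤ 1) (hx : 0 ≤ x)
    (hr : 0 < r) (h : 0 < x + r * s) (hk : 0 < k) :
    HasDerivAt (fun r => Real.sign s / (rpowChord p x s r + k))
      (|rpowChordDeriv p x s r| / (rpowChord p x s r + k) ^ 2) r := by
  have h0 := rpowChord_nonneg hp hx hr h
  have := (hasDerivAt_const r (Real.sign s)).div ((hasDerivAt_rpowChord (p := p) hr h).add_const k)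
    (by positivity)
  refine this.congr_deriv ?_
  rw [abs_rpowChordDeriv hp hp1 hx hr h]
  ring

lemma abs_sign_div_le {s d k : ℝ} (hk : 0 < k) (hd : 0 ≤ d) : |Real.sign s / (d + k)| ≤ 1 / k := by
  rw [abs_div, abs_of_pos (a := d + k) (by positivity)]
  exact div_le_div₀ zero_le_one (abs_realSign_le_one s) hk (by linarith)

/-! ### The slope of the phase along a line -/

namespace ChartLine

variable {c : ℝ} (L : ChartLine c)

/-- A primitive of `Q`. -/
noncomputable def Z (r : ℝ) : ℝ :=
  (Real.sign L.s * (L.x + r * L.s) ^ (c - 1) + Real.sign L.t * (L.y + r * L.t) ^ (c - 1)) / (c - 1)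

lemma hasDerivAt_Z {r : ℝ} (hr : r ∈ Ioc 0 L.R) : HasDerivAt L.Z (L.Q r) r := by
  have h1 := ((L.hasDerivAt_fst r).rpow_const (p := c - 1)
    (Or.inl (L.fst_pos r hr).ne')).const_mul (Real.sign L.s)
  have h2 := ((L.hasDerivAt_snd r).rpow_const (p := c - 1)
    (Or.inl (L.snd_pos r hr).ne')).const_mul (Real.sign L.t)
  refine ((h1.add h2).div_const (c - 1)).congr_deriv ?_
  have : c - 1 ≠ 0 := by linarith [L.one_lt]
  rw [show c - 1 - 1 = c - 2 by ring]
  have e : ∀ s : ℝ, |s| = Real.sign s * s := fun s => by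
    rcases lt_trichotomy s 0 with hs | rfl | hs
    · rw [Real.sign_of_neg hs, abs_of_neg hs]; ring
    · simp
    · rw [Real.sign_of_pos hs, abs_of_pos hs]; ring
  unfold Q
  rw [e, e]
  field_simp

lemma abs_Z_le {r : ℝ} (hr : r ∈ Icc 0 L.R) : |L.Z r| ≤ 2 / (c - 1) := by
  have hc : 0 < c - 1 := by linarith [L.one_lt]
  have h1 := Real.rpow_le_one (L.fst_nonneg hr) (L.fst_le_one hr) hc.le
  have h2 := Real.rpow_le_one (L.snd_nonneg hr) (L.snd_le_one hr) hc.le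
  have h3 := Real.rpow_nonneg (L.fst_nonneg hr) (c - 1)
  have h4 := Real.rpow_nonneg (L.snd_nonneg hr) (c - 1)
  unfold Z
  rw [abs_div, abs_of_pos hc]
  gcongr
  refine (abs_add_le _ _).trans ?_
  rw [abs_mul, abs_mul, abs_of_nonneg h3, abs_of_nonneg h4]
  have := mul_le_one₀ (abs_realSign_le_one L.s) h3 h1
  have := mul_le_one₀ (abs_realSign_le_one L.t) h4 h2
  linarith

/-- The derivative of the phase `ℓ r - σ h(r)`. -/
noncomputable def slope (l σ r : ℝ) : ℝ := l + σ * (L.m r * L.P r)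

lemma hasDerivAt_phase (l σ : ℝ) {r : ℝ} (hr : r ∈ Icc 0 L.R) :
    HasDerivAt (fun r => l * r - σ * L.h r) (L.slope l σ r) r := by
  refine (((hasDerivAt_id r).const_mul l).sub ((L.hasDerivAt_h hr).const_mul σ)).congr_deriv ?_
  unfold slope; ring

lemma hasDerivAt_slope (l σ : ℝ) {r : ℝ} (hr : r ∈ Ioc 0 L.R) :
    HasDerivAt (L.slope l σ)
      (σ * (L.m' r * L.P r + L.m r * ((c - 1) * L.q r))) r := by
  refine (((L.hasDerivAt_mul_P hr).const_mul σ).const_add l).congr_deriv ?_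
  unfold m'; ring

lemma P_sub_eq {r : ℝ} (hr : 0 < r) : L.P r - L.P 0 =
    r * (rpowChord (c - 1) L.x L.s r + rpowChord (c - 1) L.y L.t r) := by
  unfold P rpowChord
  field_simp
  ring_nf

/-- The singular q disappears into chord derivatives, whose signs are known. -/
lemma P_sub_sub_eq {r : ℝ} (hr : 0 < r) : L.P r - L.P 0 - r * ((c - 1) * L.q r) =
    -(r ^ 2 * (rpowChordDeriv (c - 1) L.x L.s r + rpowChordDeriv (c - 1) L.y L.t r)) := by
  unfold P q rpowChordDeriv
  rw [show c - 1 - 1 = c - 2 by ring]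
  field_simp
  ring_nf

/-- Bound for the derivative of `r / slope`. -/
lemma abs_slope_sub_le (hst : L.s ^ 2 + L.t ^ 2 = 1) {l σ : ℝ} (hσ : 0 < σ)
    (hp : 0 ≤ L.slope l σ 0) {r : ℝ} (hr : r ∈ Ioc 0 L.R) :
    |L.slope l σ r - r * (σ * (L.m' r * L.P r + L.m r * ((c - 1) * L.q r)))| ≤
      L.slope l σ 0 + σ * (3 * (r ^ 2 * (|rpowChordDeriv (c - 1) L.x L.s r| +
        |rpowChordDeriv (c - 1) L.y L.t r|)) + 684 * (r * (L.P r - L.P 0))) := by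
  have hr' := L.Ioc_subset_Icc hr
  have h0 : (0 : ℝ) ∈ Icc 0 L.R := ⟨le_rfl, L.R_pos.le⟩
  have e1 := L.P_sub_sub_eq hr.1
  have e2 := L.abs_mul_m'_sub_le hst hr
  have e3 := (L.abs_m'_le hr').trans (mul_le_mul_of_nonneg_left (L.abs_P_le hr') (by norm_num))
  have e4 := L.abs_P_le h0
  have e5 := L.m_le hr'
  have e6 := L.one_le_m hr'
  have hD : 0 ≤ L.P r - L.P 0 := by
    have := L.mul_le_P_sub le_rfl hr.1.le hr.2
    have hc := L.one_lt
    rw [hst] at this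
    nlinarith [hr.1]
  -- The defect splits into that of `P`, that of m, and a cross term. With |P 0| ≤ 2 and |m'| ≤ 18
  -- the last two contribute 684 = 2·333 + 18.
  have key : L.slope l σ r - r * (σ * (L.m' r * L.P r + L.m r * ((c - 1) * L.q r))) =
      L.slope l σ 0 + σ * (L.m r * (L.P r - L.P 0 - r * ((c - 1) * L.q r)) -
        (r * L.m' r - (L.m r - L.m 0)) * L.P 0 - r * L.m' r * (L.P r - L.P 0)) := by
    unfold slope; ring
  rw [key]
  refine (abs_add_le _ _).trans ?_
  rw [abs_of_nonneg hp, abs_mul, abs_of_pos hσ]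
  gcongr
  have n1 : |L.m r * (L.P r - L.P 0 - r * ((c - 1) * L.q r))| ≤
      3 * (r ^ 2 * (|rpowChordDeriv (c - 1) L.x L.s r| + |rpowChordDeriv (c - 1) L.y L.t r|)) := by
    rw [e1, abs_mul, abs_neg, abs_mul, abs_of_nonneg (by linarith : 0 ≤ L.m r),
      abs_of_nonneg (sq_nonneg r)]
    gcongr
    exact abs_add_le _ _
  have n2 : |(r * L.m' r - (L.m r - L.m 0)) * L.P 0| ≤ 333 * (r * (L.P r - L.P 0)) * 2 := by
    rw [abs_mul]
    exact mul_le_mul e2 e4 (abs_nonneg _) ((abs_nonneg _).trans e2)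
  have n3 : |r * L.m' r * (L.P r - L.P 0)| ≤ 18 * (r * (L.P r - L.P 0)) := by
    rw [abs_mul, abs_mul, abs_of_pos hr.1, abs_of_nonneg hD]
    have := mul_le_mul_of_nonneg_right e3 (mul_nonneg hr.1.le hD)
    linarith
  have tri : ∀ a b : ℝ, |a - b| ≤ |a| + |b| := fun a b => norm_sub_le a b
  linarith [tri (L.m r * (L.P r - L.P 0 - r * ((c - 1) * L.q r)) -
    (r * L.m' r - (L.m r - L.m 0)) * L.P 0) (r * L.m' r * (L.P r - L.P 0)),
    tri (L.m r * (L.P r - L.P 0 - r * ((c - 1) * L.q r)))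
    ((r * L.m' r - (L.m r - L.m 0)) * L.P 0)]

end ChartLine

/-! ### One-dimensional estimates: rays from a minimum and transversal lines -/

namespace ChartLine

variable {c : ℝ} (L : ChartLine c)

lemma continuousOn_phase_exp (S l σ : ℝ) : ContinuousOn
    (fun r => Complex.exp (Complex.I * (S * ((l * r - σ * L.h r : ℝ) : ℂ)))) (Icc 0 L.R) := by
  intro r hr
  refine ContinuousAt.continuousWithinAt ?_
  have h := (L.hasDerivAt_phase l σ hr).continuousAt
  have h2 : ContinuousAt (fun r => ((l * r - σ * L.h r : ℝ) : ℂ)) r :=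
    Complex.continuous_ofReal.continuousAt.comp h
  exact (continuousAt_const.mul (continuousAt_const.mul h2)).cexp

/-- Integration along a ray issuing from the minimum of a convex phase: the Jacobian factor `r`
compensates the vanishing of the derivative of the phase. -/
theorem norm_integral_ray_le (hst : L.s ^ 2 + L.t ^ 2 = 1) {l σ S A ε : ℝ} (hσ : 0 < σ)
    (hp : 0 ≤ L.slope l σ 0) (hS : |S| = 1) {a a' : ℝ → ℂ}
    (ha : ∀ r ∈ Ioc 0 L.R, HasDerivAt a (a' r) r) (haA : ∀ r ∈ Ioc 0 L.R, ‖a r‖ ≤ A)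
    (haA' : ∀ r ∈ Ioc 0 L.R, ‖a' r‖ ≤ A * L.Q r) (hε : 0 < ε) (hεR : ε ≤ L.R) :
    ‖∫ r in ε..L.R, a r * r * Complex.exp (Complex.I * (S * ((l * r - σ * L.h r : ℝ) : ℂ)))‖ ≤
      1423 / (c - 1) ^ 2 * A / σ := by
  set k := c - 1 with hk
  have hk0 : 0 < k := by linarith [L.one_lt]
  have hk1 : k ≤ 1 := by linarith [L.lt_two]
  have hA : 0 ≤ A := (norm_nonneg _).trans (haA ε ⟨hε, hεR⟩)
  set p := L.slope l σ 0 with hpdef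
  set d₁ := rpowChord k L.x L.s with hd1
  set d₂ := rpowChord k L.y L.t with hd2
  have hsub : Icc ε L.R ⊆ Ioc 0 L.R := fun r hr => ⟨hε.trans_le hr.1, hr.2⟩
  have hd1n : ∀ r ∈ Ioc 0 L.R, 0 ≤ d₁ r := fun r hr =>
    rpowChord_nonneg hk0.le L.x_nonneg hr.1 (L.fst_pos r hr)
  have hd2n : ∀ r ∈ Ioc 0 L.R, 0 ≤ d₂ r := fun r hr =>
    rpowChord_nonneg hk0.le L.y_nonneg hr.1 (L.snd_pos r hr)
  have hP : ∀ r ∈ Ioc 0 L.R, L.P r - L.P 0 = r * (d₁ r + d₂ r) := fun r hr => L.P_sub_eq hr.1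
  have hD : ∀ r ∈ Ioc 0 L.R, k ≤ d₁ r + d₂ r := fun r hr => by
    have h1 := L.mul_le_P_sub le_rfl hr.1.le hr.2
    rw [hP r hr, hst, sub_zero, mul_one, mul_comm] at h1
    exact le_of_mul_le_mul_left h1 hr.1
  have hslope : ∀ r ∈ Ioc 0 L.R, p + σ * (r * (d₁ r + d₂ r)) ≤ L.slope l σ r := fun r hr => by
    have h1 := mul_le_mul_of_nonneg_left (L.sub_le_mul_sub (L.Ioc_subset_Icc hr)) hσ.le
    rw [hP r hr] at h1
    rw [hpdef]; unfold slope; linarith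
  have hslope' : ∀ r ∈ Ioc 0 L.R, p + σ * k * r ≤ L.slope l σ r := fun r hr => by
    have h1 := mul_le_mul_of_nonneg_left (hD r hr) (mul_pos hσ hr.1).le
    have h2 := hslope r hr
    linarith
  have hslope0 : ∀ r ∈ Ioc 0 L.R, 0 < L.slope l σ r := fun r hr => by
    have := hslope' r hr
    have : 0 < σ * k * r := by have := hr.1; positivity
    linarith
  -- The Jacobian factor is written r = W ψ'. Everything rests on `W` being of size and of total
  -- variation O(1/σ).
  set W : ℝ → ℝ := fun r => r / L.slope l σ r with hW
  set T : ℝ → ℝ := fun r => σ * (L.m' r * L.P r + L.m r * ((c - 1) * L.q r)) with hT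
  set W' : ℝ → ℝ := fun r => (L.slope l σ r - r * T r) / L.slope l σ r ^ 2 with hW'
  have hWd : ∀ r ∈ Ioc 0 L.R, HasDerivAt W (W' r) r := fun r hr => by
    refine ((hasDerivAt_id r).div (L.hasDerivAt_slope l σ hr) (hslope0 r hr).ne').congr_deriv ?_
    simp only [id, hW', hT]; ring
  have hWle : ∀ r ∈ Ioc 0 L.R, |W r| ≤ 1 / (σ * k) := fun r hr => by
    rw [hW]; simp only
    rw [abs_of_pos (div_pos hr.1 (hslope0 r hr)), div_le_div_iff₀ (hslope0 r hr) (by positivity)]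
    linarith [hslope' r hr]
  -- A bounded function whose derivative dominates |W'|. The first term answers for the initial
  -- slope p, the two chord reciprocals for the defect of `P`, and the linear term for the variation
  -- of m.
  set V : ℝ → ℝ := fun r => r / (p + σ * k * r) + 12 / σ * (Real.sign L.s / (d₁ r + k)) +
    12 / σ * (Real.sign L.t / (d₂ r + k)) + 684 / (σ * k) * r with hV
  set V' : ℝ → ℝ := fun r => p / (p + σ * k * r) ^ 2 +
    12 / σ * (|rpowChordDeriv k L.x L.s r| / (d₁ r + k) ^ 2) +
    12 / σ * (|rpowChordDeriv k L.y L.t r| / (d₂ r + k) ^ 2) + 684 / (σ * k) with hV'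
  have hden : ∀ r, 0 < r → 0 < p + σ * k * r := fun r hr => by positivity
  have hVd : ∀ r ∈ Ioc 0 L.R, HasDerivAt V (V' r) r := fun r hr => by
    have h1 : HasDerivAt (fun r => r / (p + σ * k * r)) (p / (p + σ * k * r) ^ 2) r := by
      refine ((hasDerivAt_id r).div (((hasDerivAt_id r).const_mul (σ * k)).const_add p)
        (hden r hr.1).ne').congr_deriv ?_
      simp only [id]; ring
    refine ((h1.add ((hasDerivAt_sign_div_rpowChord hk0.le hk1 L.x_nonneg hr.1 (L.fst_pos r hr)
      hk0).const_mul (12 / σ))).add ((hasDerivAt_sign_div_rpowChord hk0.le hk1 L.y_nonneg hr.1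
      (L.snd_pos r hr) hk0).const_mul (12 / σ))).add ?_
    simpa using (hasDerivAt_id r).const_mul (684 / (σ * k))
  have hWV : ∀ r ∈ Ioc 0 L.R, |W' r| ≤ V' r := fun r hr => by
    have hr0 := hr.1
    have h1 := L.abs_slope_sub_le hst hσ hp hr
    rw [hP r hr] at h1
    have hDr := hD r hr
    have h2 := hslope r hr
    have g1 := hd1n r hr
    have g2 := hd2n r hr
    have hsl := hslope0 r hr
    have b1 : p / L.slope l σ r ^ 2 ≤ p / (p + σ * k * r) ^ 2 := by
      have := hslope' r hr
      have := hden r hr0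
      gcongr
    have aux : ∀ e d : ℝ, 0 ≤ d → d ≤ d₁ r + d₂ r → 0 ≤ e →
        σ * (3 * (r ^ 2 * e)) / L.slope l σ r ^ 2 ≤ 12 / σ * (e / (d + k) ^ 2) := by
      intro e d hd hdd he
      -- Both d and k are at most d₁ + d₂, hence the factor 2; its square turns the constant 3 into
      -- 12.
      have h3 : σ * r * (d + k) ≤ 2 * L.slope l σ r := by
        have : σ * r * (d + k) ≤ σ * r * (2 * (d₁ r + d₂ r)) := by gcongr; linarith
        linarith
      calc σ * (3 * (r ^ 2 * e)) / L.slope l σ r ^ 2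
          ≤ σ * (3 * (r ^ 2 * e)) / (σ * r * (d + k) / 2) ^ 2 := by
            gcongr; linarith
        _ = 12 / σ * (e / (d + k) ^ 2) := by
            have : d + k ≠ 0 := by positivity
            field_simp; ring
    have b2 := aux |rpowChordDeriv k L.x L.s r| (d₁ r) g1 (by linarith) (abs_nonneg _)
    have b3 := aux |rpowChordDeriv k L.y L.t r| (d₂ r) g2 (by linarith) (abs_nonneg _)
    have b4 : σ * (684 * (r * (r * (d₁ r + d₂ r)))) / L.slope l σ r ^ 2 ≤ 684 / (σ * k) := by
      have hDp : 0 < d₁ r + d₂ r := by linarith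
      calc σ * (684 * (r * (r * (d₁ r + d₂ r)))) / L.slope l σ r ^ 2
          ≤ σ * (684 * (r * (r * (d₁ r + d₂ r)))) / (σ * (r * (d₁ r + d₂ r))) ^ 2 := by
            gcongr; linarith
        _ = 684 / (σ * (d₁ r + d₂ r)) := by field_simp
        _ ≤ 684 / (σ * k) := by gcongr
    rw [hW', hV']; simp only
    rw [abs_div, abs_of_pos (a := L.slope l σ r ^ 2) (by positivity)]
    refine (div_le_div_of_nonneg_right h1 (by positivity)).trans ?_
    calc _ = p / L.slope l σ r ^ 2 +
          σ * (3 * (r ^ 2 * |rpowChordDeriv k L.x L.s r|)) / L.slope l σ r ^ 2 +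
          σ * (3 * (r ^ 2 * |rpowChordDeriv k L.y L.t r|)) / L.slope l σ r ^ 2 +
          σ * (684 * (r * (r * (d₁ r + d₂ r)))) / L.slope l σ r ^ 2 := by ring
      _ ≤ _ := by linarith
  have hVinc : V L.R - V ε ≤ 1417 / (σ * k) := by
    have e1 : ∀ r, 0 < r → r / (p + σ * k * r) ≤ 1 / (σ * k) := fun r hr => by
      rw [div_le_div_iff₀ (hden r hr) (by positivity)]; linarith
    have e2 : 0 ≤ ε / (p + σ * k * ε) := (div_pos hε (hden ε hε)).le
    have hRm : L.R ∈ Ioc 0 L.R := ⟨L.R_pos, le_rfl⟩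
    have hεm : ε ∈ Ioc 0 L.R := ⟨hε, hεR⟩
    have i1 := abs_le.1 (abs_sign_div_le (s := L.s) hk0 (hd1n _ hRm))
    have i2 := abs_le.1 (abs_sign_div_le (s := L.s) hk0 (hd1n _ hεm))
    have i3 := abs_le.1 (abs_sign_div_le (s := L.t) hk0 (hd2n _ hRm))
    have i4 := abs_le.1 (abs_sign_div_le (s := L.t) hk0 (hd2n _ hεm))
    have h12 : 0 ≤ 12 / σ := by positivity
    have j1 := mul_le_mul_of_nonneg_left i1.2 h12
    have j2 := mul_le_mul_of_nonneg_left i2.1 h12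
    have j3 := mul_le_mul_of_nonneg_left i3.2 h12
    have j4 := mul_le_mul_of_nonneg_left i4.1 h12
    have j5 : 684 / (σ * k) * (L.R - ε) ≤ 684 / (σ * k) * 2 := by
      gcongr; linarith [L.R_le]
    have j6 := e1 L.R L.R_pos
    have : 1417 / (σ * k) = 1 / (σ * k) + 4 * (12 / σ * (1 / k)) + 684 / (σ * k) * 2 := by
      field_simp; norm_num
    rw [hV]; simp only
    linarith
  have hmain := norm_integral_le_of_oscillating hεR hS
    (φ := fun r => a r * r * Complex.exp (Complex.I * (S * ((l * r - σ * L.h r : ℝ) : ℂ))))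
    (B := fun r => a r * W r) (B' := fun r => a' r * W r + a r * W' r)
    (ψ := fun r => l * r - σ * L.h r) (ψ' := L.slope l σ)
    (V := fun r => A / (σ * k) * L.Z r + A * V r)
    (V' := fun r => A / (σ * k) * L.Q r + A * V' r) ?_
    (fun r hr => (ha r (hsub hr)).mul (hWd r (hsub hr)).ofReal_comp)
    (fun r hr => L.hasDerivAt_phase l σ (L.Ioc_subset_Icc (hsub hr)))
    (fun r hr => ((L.hasDerivAt_Z (hsub hr)).const_mul _).add ((hVd r (hsub hr)).const_mul _))
    ?_ ?_
  -- In units of A/(σk²): 1423 = 1417 + 2 + 4, from the increment of `V`, the two boundary values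
  -- and the oscillation of `Z`.
  · have hB : ∀ r ∈ Ioc 0 L.R, ‖a r * (W r : ℂ)‖ ≤ A / (σ * k) := fun r hr => by
      rw [norm_mul, Complex.norm_real, Real.norm_eq_abs, div_eq_mul_one_div]
      exact mul_le_mul (haA r hr) (hWle r hr) (abs_nonneg _) hA
    have h1 := hB ε ⟨hε, hεR⟩
    have h2 := hB L.R ⟨L.R_pos, le_rfl⟩
    have h3 := abs_le.1 (L.abs_Z_le ⟨L.R_pos.le, le_rfl⟩)
    have h4 := abs_le.1 (L.abs_Z_le ⟨hε.le, hεR⟩)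
    have hAk : 0 ≤ A / (σ * k) := by positivity
    have h5 := mul_le_mul_of_nonneg_left h3.2 hAk
    have h6 := mul_le_mul_of_nonneg_left h4.1 hAk
    have h7 := mul_le_mul_of_nonneg_left hVinc hA
    have h8 : A / (σ * k) ≤ A / (σ * k) * (1 / k) :=
      le_mul_of_one_le_right hAk (by rw [le_div_iff₀ hk0]; linarith)
    have h9 : A * (1417 / (σ * k)) = 1417 * (A / (σ * k)) := by ring
    have h10 : 1423 / k ^ 2 * A / σ = 1423 * (A / (σ * k) * (1 / k)) := by field_simp
    have h11 : A / (σ * k) * (2 / k) = 2 * (A / (σ * k) * (1 / k)) := by ring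
    have h12 : A / (σ * k) * -(2 / k) = -2 * (A / (σ * k) * (1 / k)) := by ring
    rw [← hk, h11] at h5
    rw [← hk, h12] at h6
    rw [h10]
    linarith
  · refine ContinuousOn.mul (ContinuousOn.mul ?_ ?_) ?_
    · exact fun r hr => (ha r (hsub hr)).continuousAt.continuousWithinAt
    · exact Complex.continuous_ofReal.continuousOn
    · exact (L.continuousOn_phase_exp S l σ).mono (Icc_subset_Icc_left hε.le)
  · intro r hr
    have hr' := hsub hr
    refine (norm_add_le _ _).trans ?_
    rw [norm_mul, norm_mul, Complex.norm_real, Complex.norm_real, Real.norm_eq_abs,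
      Real.norm_eq_abs]
    refine add_le_add ?_ (mul_le_mul (haA r hr') (hWV r hr') (abs_nonneg _) hA)
    refine (mul_le_mul (haA' r hr') (hWle r hr') (abs_nonneg _)
      ((norm_nonneg _).trans (haA' r hr'))).trans (le_of_eq ?_)
    ring
  · intro r hr
    have := (hslope0 r (hsub hr)).ne'
    have h1 : ((r : ℝ) : ℂ) = (W r : ℂ) * (L.slope l σ r : ℂ) := by
      rw [← Complex.ofReal_mul, hW]; congr 1; field_simp
    rw [h1]; ring

/-- Integration along a line on which the phase has no critical point. -/
theorem norm_integral_transversal_le {l τ S A ε : ℝ} (hl : l ≠ 0) (hτ : 2 * |τ| ≤ |l|)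
    (hmP : ∀ r ∈ Ioc 0 L.R, |L.m r * L.P r| ≤ 1) (hS : |S| = 1) {a a' : ℝ → ℂ}
    (ha : ∀ r ∈ Ioc 0 L.R, HasDerivAt a (a' r) r) (haA : ∀ r ∈ Ioc 0 L.R, ‖a r‖ ≤ A)
    (haA' : ∀ r ∈ Ioc 0 L.R, ‖a' r‖ ≤ A * L.Q r) (hε : 0 < ε) (hεR : ε ≤ L.R) :
    ‖∫ r in ε..L.R, a r * Complex.exp (Complex.I * (S * ((l * r - τ * L.h r : ℝ) : ℂ)))‖ ≤
      16 / (c - 1) * A / |l| := by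
  set k := c - 1 with hk
  have hk0 : 0 < k := by linarith [L.one_lt]
  have hk1 : k ≤ 1 := by linarith [L.lt_two]
  have hA : 0 ≤ A := (norm_nonneg _).trans (haA ε ⟨hε, hεR⟩)
  have hl0 : 0 < |l| := abs_pos.2 hl
  have hsub : Icc ε L.R ⊆ Ioc 0 L.R := fun r hr => ⟨hε.trans_le hr.1, hr.2⟩
  have hslope : ∀ r ∈ Ioc 0 L.R, |l| / 2 ≤ |L.slope l τ r| := fun r hr => by
    unfold slope
    have h1 : |l| - |τ * (L.m r * L.P r)| ≤ |l + τ * (L.m r * L.P r)| := by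
      have := abs_sub_abs_le_abs_sub l (-(τ * (L.m r * L.P r)))
      rwa [abs_neg, sub_neg_eq_add] at this
    have h2 : |τ * (L.m r * L.P r)| ≤ |τ| := by
      rw [abs_mul]; exact mul_le_of_le_one_right (abs_nonneg _) (hmP r hr)
    linarith
  have hslope0 : ∀ r ∈ Ioc 0 L.R, L.slope l τ r ≠ 0 := fun r hr => by
    have := hslope r hr
    rw [← abs_pos]; linarith
  -- The derivative of mP. It is nonnegative and |mP| ≤ 1, so its integral is at most 2 although q
  -- is singular.
  set G : ℝ → ℝ := fun r => (c - 1) * (L.u r ^ (1 / c - 2) * L.P r ^ 2 + L.m r * L.q r) with hG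
  have hG0 : ∀ r ∈ Ioc 0 L.R, 0 ≤ G r := fun r hr =>
    (mul_nonneg hk0.le (L.q_nonneg hr)).trans (L.le_deriv_mul_P hr)
  set W : ℝ → ℝ := fun r => (L.slope l τ r)⁻¹ with hW
  set W' : ℝ → ℝ := fun r => -(τ * G r) / L.slope l τ r ^ 2 with hW'
  have hWd : ∀ r ∈ Ioc 0 L.R, HasDerivAt W (W' r) r := fun r hr =>
    (((L.hasDerivAt_mul_P hr).const_mul τ).const_add l).inv (hslope0 r hr)
  have hWle : ∀ r ∈ Ioc 0 L.R, |W r| ≤ 2 / |l| := fun r hr => by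
    rw [hW]; simp only
    rw [abs_inv, inv_le_comm₀ (abs_pos.2 (hslope0 r hr)) (by positivity), inv_div]
    exact hslope r hr
  have hWV : ∀ r ∈ Ioc 0 L.R, |W' r| ≤ 2 / |l| * G r := fun r hr => by
    have h1 := hslope r hr
    have h2 := hG0 r hr
    rw [hW']; simp only
    rw [abs_div, abs_neg, abs_mul, abs_of_nonneg h2, abs_pow]
    calc |τ| * G r / |L.slope l τ r| ^ 2 ≤ |l| / 2 * G r / (|l| / 2) ^ 2 := by
          gcongr; linarith
      _ = 2 / |l| * G r := by field_simp
  have hmain := norm_integral_le_of_oscillating hεR hS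
    (φ := fun r => a r * Complex.exp (Complex.I * (S * ((l * r - τ * L.h r : ℝ) : ℂ))))
    (B := fun r => a r * W r) (B' := fun r => a' r * W r + a r * W' r)
    (ψ := fun r => l * r - τ * L.h r) (ψ' := L.slope l τ)
    (V := fun r => A * (2 / |l|) * L.Z r + A * (2 / |l|) * (L.m r * L.P r))
    (V' := fun r => A * (2 / |l|) * L.Q r + A * (2 / |l|) * G r) ?_
    (fun r hr => (ha r (hsub hr)).mul (hWd r (hsub hr)).ofReal_comp)
    (fun r hr => L.hasDerivAt_phase l τ (L.Ioc_subset_Icc (hsub hr)))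
    (fun r hr => ((L.hasDerivAt_Z (hsub hr)).const_mul _).add
      ((L.hasDerivAt_mul_P (hsub hr)).const_mul _))
    ?_ ?_
  · have hB : ∀ r ∈ Ioc 0 L.R, ‖a r * (W r : ℂ)‖ ≤ A * (2 / |l|) := fun r hr => by
      rw [norm_mul, Complex.norm_real, Real.norm_eq_abs]
      exact mul_le_mul (haA r hr) (hWle r hr) (abs_nonneg _) hA
    have h1 := hB ε ⟨hε, hεR⟩
    have h2 := hB L.R ⟨L.R_pos, le_rfl⟩
    have h3 := abs_le.1 (L.abs_Z_le ⟨L.R_pos.le, le_rfl⟩)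
    have h4 := abs_le.1 (L.abs_Z_le ⟨hε.le, hεR⟩)
    have hAk : 0 ≤ A * (2 / |l|) := by positivity
    have h5 := mul_le_mul_of_nonneg_left h3.2 hAk
    have h6 := mul_le_mul_of_nonneg_left h4.1 hAk
    have h7 := mul_le_mul_of_nonneg_left (abs_le.1 (hmP L.R ⟨L.R_pos, le_rfl⟩)).2 hAk
    have h7' := mul_le_mul_of_nonneg_left (abs_le.1 (hmP ε ⟨hε, hεR⟩)).1 hAk
    have h8 : A * (2 / |l|) ≤ A * (2 / |l|) * (1 / k) :=
      le_mul_of_one_le_right hAk (by rw [le_div_iff₀ hk0]; linarith)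
    -- 8 = 2 + 4 + 2, from the two boundary values, the oscillation of `Z` and the increment of mP.
    have h10 : 16 / k * A / |l| = 8 * (A * (2 / |l|) * (1 / k)) := by field_simp; ring
    have h11 : A * (2 / |l|) * (2 / k) = 2 * (A * (2 / |l|) * (1 / k)) := by ring
    have h12 : A * (2 / |l|) * -(2 / k) = -2 * (A * (2 / |l|) * (1 / k)) := by ring
    rw [← hk, h11] at h5
    rw [← hk, h12] at h6
    rw [h10]
    linarith
  · refine ContinuousOn.mul ?_ ?_
    · exact fun r hr => (ha r (hsub hr)).continuousAt.continuousWithinAt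
    · exact (L.continuousOn_phase_exp S l τ).mono (Icc_subset_Icc_left hε.le)
  · intro r hr
    have hr' := hsub hr
    refine (norm_add_le _ _).trans ?_
    rw [norm_mul, norm_mul, Complex.norm_real, Complex.norm_real, Real.norm_eq_abs,
      Real.norm_eq_abs]
    have i1 := mul_le_mul (haA r hr') (hWV r hr') (abs_nonneg _) hA
    have i2 := mul_le_mul (haA' r hr') (hWle r hr') (abs_nonneg _)
      ((norm_nonneg _).trans (haA' r hr'))
    linarith
  · intro r hr
    have := hslope0 r (hsub hr)
    have h1 : (W r : ℂ) * (L.slope l τ r : ℂ) = 1 := by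
      rw [← Complex.ofReal_mul, hW]; simp only
      rw [inv_mul_cancel₀ this, Complex.ofReal_one]
    rw [mul_assoc (a r), h1, mul_one]

end ChartLine

/-! ### From compact subintervals to open intervals -/

lemma norm_setIntegral_Ioo_le {f : ℝ → ℂ} {ρ C : ℝ} (hρ : 0 < ρ) (hC : 0 ≤ C)
    (h : ∀ ε R, 0 < ε → ε ≤ R → R < ρ → ‖∫ r in ε..R, f r‖ ≤ C) :
    ‖∫ r in Ioo 0 ρ, f r‖ ≤ C := by
  by_cases hf : IntegrableOn f (Ioo 0 ρ)
  · have ht : Tendsto (fun t : ℝ => t) (𝓝[>] 0) (𝓝 0) := tendsto_id.mono_left nhdsWithin_le_nhds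
    have ht' : Tendsto (fun t : ℝ => ρ - t) (𝓝[>] 0) (𝓝 ρ) := by
      simpa using ht.const_sub ρ
    have hcov := aecover_Ioo_of_Icc (μ := volume) ht ht'
    have hlim := hcov.integral_tendsto_of_countably_generated hf
    refine le_of_tendsto hlim.norm ?_
    filter_upwards [Ioo_mem_nhdsGT (show (0 : ℝ) < ρ / 2 by positivity)] with t ht
    have hsub : Icc t (ρ - t) ⊆ Ioo 0 ρ := fun r hr =>
      ⟨ht.1.trans_le hr.1, by linarith [hr.2, ht.1]⟩
    rw [Measure.restrict_restrict measurableSet_Icc, inter_eq_self_of_subset_left hsub,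
      integral_Icc_eq_integral_Ioc,
      ← intervalIntegral.integral_of_le (by linarith [ht.2])]
    exact h t (ρ - t) ht.1 (by linarith [ht.2]) (by linarith [ht.1])
  -- Without integrability the integral is 0 by convention.
  · rw [integral_undef hf, norm_zero]; exact hC

/-- Integrals over an open interval `(0, ρ)`, given as a set that is star-shaped about `0`. -/
lemma norm_setIntegral_le_of_star {f : ℝ → ℂ} {S : Set ℝ} {C : ℝ} (hC : 0 ≤ C) (hS : IsOpen S)
    (hpos : ∀ r ∈ S, 0 < r) (hstar : ∀ r ∈ S, ∀ z, 0 < z → z ≤ r → z ∈ S) (hbdd : BddAbove S)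
    (h : ∀ ε R, 0 < ε → ε ≤ R → R ∈ S → ‖∫ r in ε..R, f r‖ ≤ C) :
    ‖∫ r in S, f r‖ ≤ C := by
  rcases S.eq_empty_or_nonempty with rfl | ⟨z, hz⟩
  · simpa using hC
  have hlt : ∀ r ∈ S, r < sSup S := fun r hr => by
    obtain ⟨e, he, hball⟩ := Metric.isOpen_iff.1 hS r hr
    have : r + e / 2 ∈ S := hball (by
      rw [Metric.mem_ball, Real.dist_eq, add_sub_cancel_left, abs_of_pos (by positivity)]
      linarith)
    linarith [le_csSup hbdd this]
  have hmem : ∀ r, 0 < r → r < sSup S → r ∈ S := fun r h0 h1 => by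
    obtain ⟨w, hw, hrw⟩ := exists_lt_of_lt_csSup ⟨z, hz⟩ h1
    exact hstar w hw r h0 hrw.le
  have hSeq : S = Ioo 0 (sSup S) := by
    ext r
    exact ⟨fun hr => ⟨hpos r hr, hlt r hr⟩, fun hr => hmem r hr.1 hr.2⟩
  rw [hSeq]
  exact norm_setIntegral_Ioo_le ((hpos z hz).trans (hlt z hz)) hC
    fun ε R h0 h1 h2 => h ε R h0 h1 (hmem R (h0.trans_le h1) h2)

/-! ### The region under the chart -/

/-- The domain of the graph chart: the third coordinate is the largest. -/
def chartRegion (c : ℝ) : Set (ℝ × ℝ) :=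
  {p | 0 < p.1 ∧ 0 < p.2 ∧ 2 * p.1 ^ c + p.2 ^ c < 1 ∧ p.1 ^ c + 2 * p.2 ^ c < 1}

def closedChartRegion (c : ℝ) : Set (ℝ × ℝ) :=
  {p | 0 ≤ p.1 ∧ 0 ≤ p.2 ∧ 2 * p.1 ^ c + p.2 ^ c ≤ 1 ∧ p.1 ^ c + 2 * p.2 ^ c ≤ 1}

noncomputable def chartHeight (c : ℝ) (p : ℝ × ℝ) : ℝ := (1 - p.1 ^ c - p.2 ^ c) ^ (1 / c)

noncomputable def chartPhase (c l₁ l₂ σ : ℝ) (p : ℝ × ℝ) : ℝ :=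
  l₁ * p.1 + l₂ * p.2 - σ * chartHeight c p

lemma chartRegion_subset (c : ℝ) : chartRegion c ⊆ closedChartRegion c :=
  fun _ hp => ⟨hp.1.le, hp.2.1.le, hp.2.2.1.le, hp.2.2.2.le⟩

lemma closedChartRegion_subset_Icc {c : ℝ} (hc : 0 < c) :
    closedChartRegion c ⊆ Icc 0 1 ×ˢ Icc 0 1 := by
  rintro ⟨x, y⟩ ⟨h1, h2, h3, h4⟩
  simp only at h1 h2 h3 h4
  have h5 := Real.rpow_nonneg h1 c
  have h6 := Real.rpow_nonneg h2 c
  refine ⟨⟨h1, ?_⟩, ⟨h2, ?_⟩⟩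
  · by_contra! h
    have := Real.one_lt_rpow h hc
    linarith
  · by_contra! h
    have := Real.one_lt_rpow h hc
    linarith

lemma continuous_rpow_fst {c : ℝ} (hc : 0 < c) : Continuous fun p : ℝ × ℝ => p.1 ^ c :=
  continuous_fst.rpow_const fun _ => Or.inr hc.le

lemma continuous_rpow_snd {c : ℝ} (hc : 0 < c) : Continuous fun p : ℝ × ℝ => p.2 ^ c :=
  continuous_snd.rpow_const fun _ => Or.inr hc.le

lemma isOpen_chartRegion {c : ℝ} (hc : 0 < c) : IsOpen (chartRegion c) := by
  have h1 := continuous_rpow_fst hc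
  have h2 := continuous_rpow_snd hc
  exact (isOpen_lt continuous_const continuous_fst).inter
    ((isOpen_lt continuous_const continuous_snd).inter
    ((isOpen_lt ((continuous_const.mul h1).add h2) continuous_const).inter
    (isOpen_lt (h1.add (continuous_const.mul h2)) continuous_const)))

lemma isCompact_closedChartRegion {c : ℝ} (hc : 0 < c) : IsCompact (closedChartRegion c) := by
  have h1 := continuous_rpow_fst hc
  have h2 := continuous_rpow_snd hc
  refine (isCompact_Icc.prod isCompact_Icc).of_isClosed_subset ?_ (closedChartRegion_subset_Icc hc)
  exact (isClosed_le continuous_const continuous_fst).inter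
    ((isClosed_le continuous_const continuous_snd).inter
    ((isClosed_le ((continuous_const.mul h1).add h2) continuous_const).inter
    (isClosed_le (h1.add (continuous_const.mul h2)) continuous_const)))

lemma continuous_chartHeight {c : ℝ} (hc : 0 < c) : Continuous (chartHeight c) :=
  ((continuous_const.sub (continuous_rpow_fst hc)).sub (continuous_rpow_snd hc)).rpow_const
    fun _ => Or.inr (by positivity)

lemma continuous_chartPhase {c : ℝ} (hc : 0 < c) (l₁ l₂ σ : ℝ) :
    Continuous (chartPhase c l₁ l₂ σ) :=
  ((continuous_const.mul continuous_fst).add (continuous_const.mul continuous_snd)).sub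
    (continuous_const.mul (continuous_chartHeight hc))

lemma zero_mem_closedChartRegion {c : ℝ} (hc : 0 < c) : (0 : ℝ × ℝ) ∈ closedChartRegion c := by
  simp [closedChartRegion, Real.zero_rpow hc.ne']

/-- The chart region is star-shaped about the points of its closure. -/
lemma add_mul_mem_chartRegion {c : ℝ} (hc : 1 ≤ c) {x y s t r z : ℝ}
    (h0 : (x, y) ∈ closedChartRegion c) (h1 : (x + r * s, y + r * t) ∈ chartRegion c)
    (hz : 0 < z) (hzr : z ≤ r) : (x + z * s, y + z * t) ∈ chartRegion c := by
  obtain ⟨a1, a2, a3, a4⟩ := h0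
  obtain ⟨b1, b2, b3, b4⟩ := h1
  simp only at a1 a2 a3 a4 b1 b2 b3 b4
  have hr : 0 < r := hz.trans_le hzr
  set τ := z / r with hτ
  have hτ0 : 0 < τ := by positivity
  have hτ1 : τ ≤ 1 := by rw [hτ, div_le_one hr]; exact hzr
  have e1 : x + z * s = (1 - τ) * x + τ * (x + r * s) := by rw [hτ]; field_simp; ring
  have e2 : y + z * t = (1 - τ) * y + τ * (y + r * t) := by rw [hτ]; field_simp; ring
  have c1 := (convexOn_rpow hc).2 (mem_Ici.2 a1) (mem_Ici.2 b1.le) (sub_nonneg.2 hτ1) hτ0.le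
    (by ring)
  have c2 := (convexOn_rpow hc).2 (mem_Ici.2 a2) (mem_Ici.2 b2.le) (sub_nonneg.2 hτ1) hτ0.le
    (by ring)
  simp only [smul_eq_mul] at c1 c2
  rw [e1, e2]
  have d1 := mul_lt_mul_of_pos_left b3 hτ0
  have d2 := mul_lt_mul_of_pos_left b4 hτ0
  have d3 := mul_le_mul_of_nonneg_left a3 (sub_nonneg.2 hτ1)
  have d4 := mul_le_mul_of_nonneg_left a4 (sub_nonneg.2 hτ1)
  have f1 := mul_nonneg (sub_nonneg.2 hτ1) a1
  have f2 := mul_nonneg (sub_nonneg.2 hτ1) a2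
  have f3 := mul_pos hτ0 b1
  have f4 := mul_pos hτ0 b2
  refine ⟨?_, ?_, ?_, ?_⟩ <;> simp only <;> linarith

/-- The chart line from a point of the closed region to a point of the region. -/
@[simps]
def ChartLine.ofMem {c x y s t R : ℝ} (hc1 : 1 < c) (hc2 : c < 2) (hs : |s| ≤ 1) (ht : |t| ≤ 1)
    (hR : 0 < R) (hR2 : R ≤ 2) (h0 : (x, y) ∈ closedChartRegion c)
    (h1 : (x + R * s, y + R * t) ∈ chartRegion c) : ChartLine c where
  x := x
  y := y
  s := s
  t := t
  R := R
  one_lt := hc1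
  lt_two := hc2
  R_pos := hR
  R_le := hR2
  x_nonneg := h0.1
  y_nonneg := h0.2.1
  abs_s_le := hs
  abs_t_le := ht
  fst_pos r hr := (add_mul_mem_chartRegion hc1.le h0 h1 hr.1 hr.2).1
  snd_pos r hr := (add_mul_mem_chartRegion hc1.le h0 h1 hr.1 hr.2).2.1
  fst_le r hr := by
    rcases hr.1.eq_or_lt with rfl | h
    · simpa using h0.2.2.1
    · exact (add_mul_mem_chartRegion hc1.le h0 h1 h hr.2).2.2.1.le
  snd_le r hr := by
    rcases hr.1.eq_or_lt with rfl | h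
    · simpa using h0.2.2.2
    · exact (add_mul_mem_chartRegion hc1.le h0 h1 h hr.2).2.2.2.le

/-! ### Amplitudes and decay of the planar integral -/

/-- Amplitudes that are bounded, with derivatives along lines at most those of `x ^ (c - 1)` and
`y ^ (c - 1)`. -/
structure IsChartAmplitude (c A : ℝ) (b : ℝ × ℝ → ℂ) : Prop where
  measurable : Measurable b
  norm_le : ∀ p ∈ chartRegion c, ‖b p‖ ≤ A
  -- Not contained in the previous field, since a chart line may touch the curves that bound the
  -- closed region.
  line_norm_le : ∀ L : ChartLine c, ∀ r ∈ Ioc 0 L.R, ‖b (L.x + r * L.s, L.y + r * L.t)‖ ≤ A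
  exists_hasDerivAt : ∀ L : ChartLine c, ∀ r ∈ Ioc 0 L.R, ∃ a',
    HasDerivAt (fun r => b (L.x + r * L.s, L.y + r * L.t)) a' r ∧ ‖a'‖ ≤ A * L.Q r

namespace ChartLine

variable {c : ℝ} (L : ChartLine c)

lemma chartPhase_eq (l₁ l₂ σ r : ℝ) : chartPhase c l₁ l₂ σ (L.x + r * L.s, L.y + r * L.t) =
    (l₁ * L.x + l₂ * L.y) + ((l₁ * L.s + l₂ * L.t) * r - σ * L.h r) := by
  unfold chartPhase chartHeight h u
  ring

/-- One-sided difference quotients at a minimum are nonnegative. At a boundary minimum the slope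
need not vanish, so only the inequality is available. -/
lemma slope_zero_nonneg {l₁ l₂ σ : ℝ} (hmin : ∀ r ∈ Icc 0 L.R, chartPhase c l₁ l₂ σ (L.x, L.y) ≤
    chartPhase c l₁ l₂ σ (L.x + r * L.s, L.y + r * L.t)) :
    0 ≤ L.slope (l₁ * L.s + l₂ * L.t) σ 0 := by
  have hd := (L.hasDerivAt_phase (l₁ * L.s + l₂ * L.t) σ
    ⟨le_rfl, L.R_pos.le⟩).tendsto_slope_zero_right
  refine ge_of_tendsto hd ?_
  filter_upwards [Ioo_mem_nhdsGT L.R_pos] with r hr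
  have h1 := hmin r ⟨hr.1.le, hr.2.le⟩
  have h2 := L.chartPhase_eq l₁ l₂ σ 0
  rw [zero_mul, zero_mul, add_zero, add_zero] at h2
  rw [L.chartPhase_eq, h2] at h1
  rw [zero_add, smul_eq_mul]
  have := hr.1
  exact mul_nonneg (by positivity) (by linarith)

end ChartLine

lemma norm_exp_I_mul (S x : ℝ) : ‖Complex.exp (Complex.I * (S * x))‖ = 1 := by
  have := Complex.norm_exp_ofReal_mul_I (S * x)
  rw [mul_comm Complex.I]; exact_mod_cast this

/-- The oscillating integrand in the chart, with the phase multiplied by a sign `S`. -/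
noncomputable def chartIntegrand (c S l₁ l₂ σ : ℝ) (b : ℝ × ℝ → ℂ) (p : ℝ × ℝ) : ℂ :=
  b p * Complex.exp (Complex.I * (S * chartPhase c l₁ l₂ σ p))

lemma norm_chartIntegrand (c S l₁ l₂ σ : ℝ) (b : ℝ × ℝ → ℂ) (p : ℝ × ℝ) :
    ‖chartIntegrand c S l₁ l₂ σ b p‖ = ‖b p‖ := by
  rw [chartIntegrand, norm_mul, norm_exp_I_mul, mul_one]

namespace ChartLine

variable {c : ℝ} (L : ChartLine c)

lemma chartIntegrand_eq (S l₁ l₂ σ : ℝ) (b : ℝ × ℝ → ℂ) (r : ℝ) :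
    chartIntegrand c S l₁ l₂ σ b (L.x + r * L.s, L.y + r * L.t) =
      Complex.exp (Complex.I * (S * (l₁ * L.x + l₂ * L.y : ℝ))) *
      (b (L.x + r * L.s, L.y + r * L.t) *
        Complex.exp (Complex.I * (S * (((l₁ * L.s + l₂ * L.t) * r - σ * L.h r : ℝ) : ℂ)))) := by
  rw [chartIntegrand, L.chartPhase_eq, Complex.ofReal_add, mul_add, mul_add, Complex.exp_add]
  ring

end ChartLine

section
variable {c A S : ℝ} {b : ℝ × ℝ → ℂ}

lemma IsChartAmplitude.norm_ray_le (hb : IsChartAmplitude c A b) (hS : |S| = 1) {l₁ l₂ σ : ℝ}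
    (hσ : 0 < σ) (L : ChartLine c) (hst : L.s ^ 2 + L.t ^ 2 = 1)
    (hmin : ∀ r ∈ Icc 0 L.R, chartPhase c l₁ l₂ σ (L.x, L.y) ≤
      chartPhase c l₁ l₂ σ (L.x + r * L.s, L.y + r * L.t)) {ε : ℝ} (hε : 0 < ε) (hεR : ε ≤ L.R) :
    ‖∫ r in ε..L.R, r • chartIntegrand c S l₁ l₂ σ b (L.x + r * L.s, L.y + r * L.t)‖ ≤
      1423 / (c - 1) ^ 2 * A / σ := by
  choose! a' ha' using hb.exists_hasDerivAt L
  have h := L.norm_integral_ray_le hst (S := S) hσ (L.slope_zero_nonneg hmin) hS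
    (fun r hr => (ha' r hr).1) (hb.line_norm_le L) (fun r hr => (ha' r hr).2) hε hεR
  have e : ∀ r : ℝ, r • chartIntegrand c S l₁ l₂ σ b (L.x + r * L.s, L.y + r * L.t) =
      Complex.exp (Complex.I * (S * (l₁ * L.x + l₂ * L.y : ℝ))) *
      (b (L.x + r * L.s, L.y + r * L.t) * r *
        Complex.exp (Complex.I * (S * (((l₁ * L.s + l₂ * L.t) * r - σ * L.h r : ℝ) : ℂ)))) := by
    intro r
    rw [L.chartIntegrand_eq, Complex.real_smul]
    ring
  simp_rw [e]
  rw [intervalIntegral.integral_const_mul, norm_mul, norm_exp_I_mul, one_mul]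
  exact h

lemma IsChartAmplitude.norm_transversal_le (hb : IsChartAmplitude c A b) (hS : |S| = 1)
    {l₁ l₂ τ : ℝ} (L : ChartLine c) (hl : l₁ * L.s + l₂ * L.t ≠ 0)
    (hτ : 2 * |τ| ≤ |l₁ * L.s + l₂ * L.t|)
    (hmP : ∀ r ∈ Ioc 0 L.R, |L.m r * L.P r| ≤ 1) {ε : ℝ} (hε : 0 < ε) (hεR : ε ≤ L.R) :
    ‖∫ r in ε..L.R, chartIntegrand c S l₁ l₂ τ b (L.x + r * L.s, L.y + r * L.t)‖ ≤
      16 / (c - 1) * A / |l₁ * L.s + l₂ * L.t| := by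
  choose! a' ha' using hb.exists_hasDerivAt L
  have h := L.norm_integral_transversal_le (S := S) hl hτ hmP hS
    (fun r hr => (ha' r hr).1) (hb.line_norm_le L) (fun r hr => (ha' r hr).2) hε hεR
  simp_rw [L.chartIntegrand_eq]
  rw [intervalIntegral.integral_const_mul, norm_mul, norm_exp_I_mul, one_mul]
  exact h

lemma IsChartAmplitude.measurable_indicator (hb : IsChartAmplitude c A b) (hc : 0 < c)
    (S l₁ l₂ σ : ℝ) :
    Measurable ((chartRegion c).indicator (chartIntegrand c S l₁ l₂ σ b)) := by
  refine Measurable.indicator (hb.measurable.mul ?_) (isOpen_chartRegion hc).measurableSet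
  have := continuous_chartPhase hc l₁ l₂ σ
  exact Continuous.measurable (by fun_prop)

lemma IsChartAmplitude.norm_indicator_le (hb : IsChartAmplitude c A b) (hA : 0 ≤ A)
    (S l₁ l₂ σ : ℝ) (p : ℝ × ℝ) :
    ‖(chartRegion c).indicator (chartIntegrand c S l₁ l₂ σ b) p‖ ≤ A := by
  by_cases hp : p ∈ chartRegion c
  · rw [indicator_of_mem hp, norm_chartIntegrand]; exact hb.norm_le p hp
  · rw [indicator_of_notMem hp, norm_zero]; exact hA

lemma IsChartAmplitude.nonneg (hb : IsChartAmplitude c A b) (hc1 : 1 < c) : 0 ≤ A := by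
  refine (norm_nonneg _).trans (hb.norm_le (1 / 4, 1 / 4) ?_)
  have h : (1 / 4 : ℝ) ^ c < 1 / 3 := by
    calc (1 / 4 : ℝ) ^ c ≤ (1 / 4 : ℝ) ^ (1 : ℝ) :=
          Real.rpow_le_rpow_of_exponent_ge (by norm_num) (by norm_num) hc1.le
      _ < 1 / 3 := by norm_num
  refine ⟨by norm_num, by norm_num, ?_, ?_⟩ <;> simp only <;> linarith

lemma norm_integral_line_le {x y s t C : ℝ} (hc1 : 1 < c) (hc2 : c < 2) (hs : |s| ≤ 1)
    (ht : |t| ≤ 1) (h0 : (x, y) ∈ closedChartRegion c)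
    (hle : ∀ r, 0 < r → (x + r * s, y + r * t) ∈ chartRegion c → r ≤ 2) {g : ℝ → ℂ} (hC : 0 ≤ C)
    (h : ∀ L : ChartLine c, L.x = x → L.y = y → L.s = s → L.t = t → ∀ ε, 0 < ε → ε ≤ L.R →
      ‖∫ r in ε..L.R, g r‖ ≤ C) :
    ‖∫ r in {r | 0 < r ∧ (x + r * s, y + r * t) ∈ chartRegion c}, g r‖ ≤ C := by
  have hc : 0 < c := by linarith
  refine norm_setIntegral_le_of_star hC ?_ (fun r hr => hr.1)
    (fun r hr z hz hzr => ⟨hz, add_mul_mem_chartRegion hc1.le h0 hr.2 hz hzr⟩)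
    ⟨2, fun r hr => hle r hr.1 hr.2⟩ ?_
  · exact isOpen_Ioi.inter ((isOpen_chartRegion hc).preimage (by fun_prop))
  · intro ε R hε hεR hR
    exact h (ChartLine.ofMem hc1 hc2 hs ht hR.1 (hle R hR.1 hR.2) h0 hR.2) rfl rfl rfl rfl ε hε hεR

/-- Decay in the presence of a critical point. -/
theorem IsChartAmplitude.norm_integral_le (hb : IsChartAmplitude c A b) (hc1 : 1 < c) (hc2 : c < 2)
    (hS : |S| = 1) {l₁ l₂ σ : ℝ} (hσ : 0 < σ) :
    ‖∫ p in chartRegion c, chartIntegrand c S l₁ l₂ σ b p‖ ≤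
      2 * Real.pi * (1423 / (c - 1) ^ 2 * A / σ) := by
  have hc : 0 < c := by linarith
  have hA := hb.nonneg hc1
  -- The minimum point, supplied by compactness, is the origin of the polar coordinates below; the
  -- region is star-shaped about it.
  obtain ⟨⟨x₀, y₀⟩, h0, hmin⟩ := (isCompact_closedChartRegion hc).exists_isMinOn
    ⟨0, zero_mem_closedChartRegion hc⟩ (continuous_chartPhase hc l₁ l₂ σ).continuousOn
  set φ := (chartRegion c).indicator (chartIntegrand c S l₁ l₂ σ b) with hφ
  have hφm : Measurable φ := hb.measurable_indicator hc S l₁ l₂ σ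
  have hφA : ∀ p, ‖φ p‖ ≤ A := hb.norm_indicator_le hA S l₁ l₂ σ
  set F : ℝ × ℝ → ℂ := fun q => q.1 • φ (x₀ + q.1 * Real.cos q.2, y₀ + q.1 * Real.sin q.2) with hF
  have hFm : Measurable F := by
    refine measurable_fst.smul (hφm.comp ?_)
    exact Continuous.measurable (by fun_prop)
  have h0' := closedChartRegion_subset_Icc hc h0
  have hle2 : ∀ r θ : ℝ, 0 ≤ r → (x₀ + r * Real.cos θ, y₀ + r * Real.sin θ) ∈ chartRegion c →
      r ≤ 2 := fun r θ hr h => by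
    have h1 := closedChartRegion_subset_Icc hc (chartRegion_subset c h)
    have h2 : (r * Real.cos θ) ^ 2 ≤ 1 := by
      have := h1.1; have := h0'.1
      simp only [mem_Icc] at *
      rw [sq_le_one_iff_abs_le_one, abs_le]; constructor <;> linarith
    have h3 : (r * Real.sin θ) ^ 2 ≤ 1 := by
      have := h1.2; have := h0'.2
      simp only [mem_Icc] at *
      rw [sq_le_one_iff_abs_le_one, abs_le]; constructor <;> linarith
    have h4 : r ^ 2 ≤ 2 := by
      have : r ^ 2 = (r * Real.cos θ) ^ 2 + (r * Real.sin θ) ^ 2 := by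
        rw [mul_pow, mul_pow, ← mul_add, Real.cos_sq_add_sin_sq, mul_one]
      linarith
    nlinarith
  have hint : ∫ p in chartRegion c, chartIntegrand c S l₁ l₂ σ b p =
      ∫ q in Ioi 0 ×ˢ Ioo (-Real.pi) Real.pi, F q := by
    rw [← integral_indicator (isOpen_chartRegion hc).measurableSet,
      ← integral_add_left_eq_self _ (x₀, y₀), ← integral_comp_polarCoord_symm, polarCoord_target]
    rfl
  have hFi : IntegrableOn F (Ioi 0 ×ˢ Ioo (-Real.pi) Real.pi) := by
    have hI : IntegrableOn F (Ioc 0 2 ×ˢ Ioo (-Real.pi) Real.pi) := by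
      refine Measure.integrableOn_of_bounded (M := 2 * A) ?_ hFm.aestronglyMeasurable ?_
      · rw [Measure.volume_eq_prod, Measure.prod_prod]
        exact (ENNReal.mul_lt_top (by simp) (by simp)).ne
      · filter_upwards [ae_restrict_mem (measurableSet_Ioc.prod measurableSet_Ioo)] with q hq
        rw [hF]; simp only
        rw [norm_smul, Real.norm_eq_abs, abs_of_pos hq.1.1]
        exact mul_le_mul hq.1.2 (hφA _) (norm_nonneg _) (by norm_num)
    -- Two points of the unit square are at distance at most √2, so the integrand vanishes for r >
    -- 2.
    refine hI.of_forall_sdiff_eq_zero (measurableSet_Ioi.prod measurableSet_Ioo) ?_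
    rintro ⟨r, θ⟩ ⟨⟨hr, hθ⟩, hn⟩
    have : (x₀ + r * Real.cos θ, y₀ + r * Real.sin θ) ∉ chartRegion c := fun h =>
      hn ⟨⟨hr, hle2 r θ (le_of_lt hr) h⟩, hθ⟩
    simp only [hF, hφ, indicator_of_notMem this, smul_zero]
  have hC : 0 ≤ 1423 / (c - 1) ^ 2 * A / σ := by positivity
  have hray : ∀ θ, ‖∫ r in Ioi 0, F (r, θ)‖ ≤ 1423 / (c - 1) ^ 2 * A / σ := fun θ => by
    have e : ∀ r, F (r, θ) = ((fun r : ℝ => (x₀ + r * Real.cos θ,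
        y₀ + r * Real.sin θ)) ⁻¹' chartRegion c).indicator (fun r => r • chartIntegrand c S l₁ l₂ σ b
          (x₀ + r * Real.cos θ, y₀ + r * Real.sin θ)) r := fun r => by
      by_cases h : (x₀ + r * Real.cos θ, y₀ + r * Real.sin θ) ∈ chartRegion c
      · rw [indicator_of_mem (by exact h)]
        simp only [hF, hφ, indicator_of_mem h]
      · rw [indicator_of_notMem (by exact h)]
        simp only [hF, hφ, indicator_of_notMem h, smul_zero]
    simp_rw [e]
    rw [setIntegral_indicator
      ((isOpen_chartRegion hc).preimage (by fun_prop : Continuous fun r : ℝ =>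
        (x₀ + r * Real.cos θ, y₀ + r * Real.sin θ))).measurableSet]
    refine norm_integral_line_le hc1 hc2 (Real.abs_cos_le_one θ) (Real.abs_sin_le_one θ) h0
      (fun r hr h => hle2 r θ hr.le h) hC ?_
    rintro L rfl rfl hs ht ε hε hεR
    rw [← hs, ← ht]
    refine hb.norm_ray_le hS hσ L (by rw [hs, ht, Real.cos_sq_add_sin_sq]) (fun r hr => ?_) hε hεR
    exact hmin ⟨L.fst_nonneg hr, L.snd_nonneg hr, L.fst_le r hr, L.snd_le r hr⟩
  rw [hint, Measure.volume_eq_prod, ← Measure.prod_restrict, integral_prod_symm]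
  · refine (norm_setIntegral_le_of_norm_le_const (by simp) (fun θ _ => hray θ)).trans (le_of_eq ?_)
    rw [Real.volume_real_Ioo_of_le (by linarith [Real.pi_pos])]
    ring
  · rw [Measure.prod_restrict]; exact hFi

lemma IsChartAmplitude.integrable_indicator (hb : IsChartAmplitude c A b) (hc1 : 1 < c)
    (S l₁ l₂ σ : ℝ) :
    Integrable ((chartRegion c).indicator (chartIntegrand c S l₁ l₂ σ b)) := by
  have hc : 0 < c := by linarith
  have hsub := (chartRegion_subset c).trans (closedChartRegion_subset_Icc hc)
  rw [integrable_indicator_iff (isOpen_chartRegion hc).measurableSet]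
  have hI : IntegrableOn ((chartRegion c).indicator (chartIntegrand c S l₁ l₂ σ b))
      (chartRegion c) := by
    refine Measure.integrableOn_of_bounded (M := A) ?_
      (hb.measurable_indicator hc S l₁ l₂ σ).aestronglyMeasurable
      (Eventually.of_forall (hb.norm_indicator_le (hb.nonneg hc1) S l₁ l₂ σ))
    refine ((measure_mono hsub).trans_lt ?_).ne
    exact (isCompact_Icc.prod isCompact_Icc).measure_lt_top
  exact hI.congr_fun (fun p hp => indicator_of_mem hp _) (isOpen_chartRegion hc).measurableSet

lemma norm_integral_le_of_Icc {G : ℝ → ℂ} {C : ℝ} (hG : ∀ y, ‖G y‖ ≤ C)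
    (h0 : ∀ y, y ∉ Icc (0 : ℝ) 1 → G y = 0) : ‖∫ y, G y‖ ≤ C := by
  rw [← setIntegral_eq_integral_of_forall_compl_eq_zero h0]
  refine (norm_setIntegral_le_of_norm_le_const (by simp) (fun y _ => hG y)).trans (le_of_eq ?_)
  simp

/-- With h = u^(1/c) ≥ x, the left side is (x/h)^(c-1). It is the modulus of a partial derivative of
the height, at most 1 where the third coordinate is the largest. -/
lemma height_rpow_mul_le_one (hc1 : 1 < c) {x u : ℝ} (hx : 0 ≤ x) (hu : 0 < u) (h : x ^ c ≤ u) :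
    u ^ (1 / c - 1) * x ^ (c - 1) ≤ 1 := by
  have hc : 0 < c := by linarith
  have h1 : x ^ (c - 1) ≤ u ^ ((c - 1) / c) := by
    have := Real.rpow_le_rpow (Real.rpow_nonneg hx c) h
      (div_nonneg (by linarith) hc.le : 0 ≤ (c - 1) / c)
    rwa [← Real.rpow_mul hx, mul_div_cancel₀ _ hc.ne'] at this
  calc u ^ (1 / c - 1) * x ^ (c - 1) ≤ u ^ (1 / c - 1) * u ^ ((c - 1) / c) := by gcongr
    _ = 1 := by
      rw [← Real.rpow_add hu, show 1 / c - 1 + (c - 1) / c = 0 by field_simp; ring,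
        Real.rpow_zero]

/-- Decay when the phase varies most in the first coordinate. -/
theorem IsChartAmplitude.norm_integral_le_fst (hb : IsChartAmplitude c A b) (hc1 : 1 < c)
    (hc2 : c < 2) (hS : |S| = 1) {l₁ l₂ τ : ℝ} (hl : l₁ ≠ 0) (hτ : 2 * |τ| ≤ |l₁|) :
    ‖∫ p in chartRegion c, chartIntegrand c S l₁ l₂ τ b p‖ ≤ 16 / (c - 1) * A / |l₁| := by
  have hc : 0 < c := by linarith
  have hc0 : 0 < c - 1 := by linarith
  have hA := hb.nonneg hc1
  have hC : 0 ≤ 16 / (c - 1) * A / |l₁| := by positivity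
  have hsub := (chartRegion_subset c).trans (closedChartRegion_subset_Icc hc)
  rw [← integral_indicator (isOpen_chartRegion hc).measurableSet, Measure.volume_eq_prod,
    integral_prod_symm _ (hb.integrable_indicator hc1 S l₁ l₂ τ)]
  refine norm_integral_le_of_Icc (fun y => ?_) (fun y hy => ?_)
  · by_cases hne : ∃ x, (x, y) ∈ chartRegion c
    swap
    · push Not at hne
      simp only [indicator_of_notMem (hne _), integral_zero, norm_zero]; exact hC
    obtain ⟨x, h1, h2, h3, h4⟩ := hne
    simp only at h1 h2 h3 h4
    -- A horizontal slice can be started on the axis, because lowering x preserves the constraints.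
    have h0 : ((0 : ℝ), y) ∈ closedChartRegion c := by
      have := Real.rpow_nonneg h1.le c
      refine ⟨le_rfl, h2.le, ?_, ?_⟩ <;> simp only <;> rw [Real.zero_rpow hc.ne'] <;> linarith
    have e : ∀ x, (chartRegion c).indicator (chartIntegrand c S l₁ l₂ τ b) (x, y) =
        {r | 0 < r ∧ (0 + r * 1, y + r * 0) ∈ chartRegion c}.indicator
          (fun r => chartIntegrand c S l₁ l₂ τ b (0 + r * 1, y + r * 0)) x := fun x => by
      simp only [zero_add, mul_one, mul_zero, add_zero, indicator, mem_ofPred_eq]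
      have : (x, y) ∈ chartRegion c → 0 < x := fun h => h.1
      by_cases h : (x, y) ∈ chartRegion c <;> simp [h, this]
    simp_rw [e]
    rw [integral_indicator]
    · refine norm_integral_line_le hc1 hc2 (by simp) (by simp) h0
        (fun r hr h => ?_) hC ?_
      · have := (hsub h).1.2
        simp only at this; linarith
      · rintro L hx rfl hs ht ε hε hεR
        have e1 : l₁ * L.s + l₂ * L.t = l₁ := by rw [hs, ht]; ring
        have e2 : ∀ r : ℝ, ((0 : ℝ) + r * 1, L.y + r * 0) = (L.x + r * L.s, L.y + r * L.t) := by
          intro r; rw [hx, hs, ht]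
        simp_rw [e2]
        have := hb.norm_transversal_le hS (l₁ := l₁) (l₂ := l₂) (τ := τ) L (by rwa [e1])
          (by rwa [e1]) (fun r hr => ?_) hε hεR
        · rwa [e1] at this
        · have hr' := L.Ioc_subset_Icc hr
          have hm := L.one_le_m hr'
          have hx0 := L.fst_nonneg hr'
          have hP : L.P r = (L.x + r * L.s) ^ (c - 1) := by
            unfold ChartLine.P; rw [ht, zero_mul, add_zero, hs, one_mul]
          rw [hP, abs_of_nonneg (mul_nonneg (by linarith) (Real.rpow_nonneg hx0 _))]
          refine height_rpow_mul_le_one hc1 hx0 (L.u_pos hr') ?_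
          have := L.fst_le r hr'
          unfold ChartLine.u; linarith
    · exact (isOpen_Ioi.inter ((isOpen_chartRegion hc).preimage (by fun_prop))).measurableSet
  · have : ∀ x, (x, y) ∉ chartRegion c := fun x h => hy (hsub h).2
    simp only [indicator_of_notMem (this _), integral_zero]

/-- Decay when the phase varies most in the second coordinate. -/
theorem IsChartAmplitude.norm_integral_le_snd (hb : IsChartAmplitude c A b) (hc1 : 1 < c)
    (hc2 : c < 2) (hS : |S| = 1) {l₁ l₂ τ : ℝ} (hl : l₂ ≠ 0) (hτ : 2 * |τ| ≤ |l₂|) :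
    ‖∫ p in chartRegion c, chartIntegrand c S l₁ l₂ τ b p‖ ≤ 16 / (c - 1) * A / |l₂| := by
  have hc : 0 < c := by linarith
  have hc0 : 0 < c - 1 := by linarith
  have hA := hb.nonneg hc1
  have hC : 0 ≤ 16 / (c - 1) * A / |l₂| := by positivity
  have hsub := (chartRegion_subset c).trans (closedChartRegion_subset_Icc hc)
  rw [← integral_indicator (isOpen_chartRegion hc).measurableSet, Measure.volume_eq_prod,
    integral_prod _ (hb.integrable_indicator hc1 S l₁ l₂ τ)]
  refine norm_integral_le_of_Icc (fun x => ?_) (fun x hx => ?_)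
  · by_cases hne : ∃ y, (x, y) ∈ chartRegion c
    swap
    · push Not at hne
      simp only [indicator_of_notMem (hne _), integral_zero, norm_zero]; exact hC
    obtain ⟨y, h1, h2, h3, h4⟩ := hne
    simp only at h1 h2 h3 h4
    have h0 : (x, (0 : ℝ)) ∈ closedChartRegion c := by
      have := Real.rpow_nonneg h2.le c
      refine ⟨h1.le, le_rfl, ?_, ?_⟩ <;> simp only <;> rw [Real.zero_rpow hc.ne'] <;> linarith
    have e : ∀ y, (chartRegion c).indicator (chartIntegrand c S l₁ l₂ τ b) (x, y) =
        {r | 0 < r ∧ (x + r * 0, 0 + r * 1) ∈ chartRegion c}.indicator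
          (fun r => chartIntegrand c S l₁ l₂ τ b (x + r * 0, 0 + r * 1)) y := fun y => by
      simp only [zero_add, mul_one, mul_zero, add_zero, indicator, mem_ofPred_eq]
      have : (x, y) ∈ chartRegion c → 0 < y := fun h => h.2.1
      by_cases h : (x, y) ∈ chartRegion c <;> simp [h, this]
    simp_rw [e]
    rw [integral_indicator]
    · refine norm_integral_line_le hc1 hc2 (by simp) (by simp) h0
        (fun r hr h => ?_) hC ?_
      · have := (hsub h).2.2
        simp only at this; linarith
      · rintro L rfl hy hs ht ε hε hεR
        have e1 : l₁ * L.s + l₂ * L.t = l₂ := by rw [hs, ht]; ring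
        have e2 : ∀ r : ℝ, (L.x + r * 0, (0 : ℝ) + r * 1) = (L.x + r * L.s, L.y + r * L.t) := by
          intro r; rw [hy, hs, ht]
        simp_rw [e2]
        have := hb.norm_transversal_le hS (l₁ := l₁) (l₂ := l₂) (τ := τ) L (by rwa [e1])
          (by rwa [e1]) (fun r hr => ?_) hε hεR
        · rwa [e1] at this
        · have hr' := L.Ioc_subset_Icc hr
          have hm := L.one_le_m hr'
          have hx0 := L.snd_nonneg hr'
          have hP : L.P r = (L.y + r * L.t) ^ (c - 1) := by
            unfold ChartLine.P; rw [hs, zero_mul, zero_add, ht, one_mul]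
          rw [hP, abs_of_nonneg (mul_nonneg (by linarith) (Real.rpow_nonneg hx0 _))]
          refine height_rpow_mul_le_one hc1 hx0 (L.u_pos hr') ?_
          have := L.snd_le r hr'
          unfold ChartLine.u; linarith
    · exact (isOpen_Ioi.inter ((isOpen_chartRegion hc).preimage (by fun_prop))).measurableSet
  · have : ∀ y, (x, y) ∉ chartRegion c := fun y h => hx (hsub h).1
    simp only [indicator_of_notMem (this _), integral_zero]
end

/-! ### From functions on space to amplitudes on the chart -/

/-- Functions on `ℝ³` that are bounded on the part of the unit cube off the coordinate planes, with
first derivatives there at most those of `|x_j| ^ (c - 1)`. -/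
structure IsSphereSymbol (c A : ℝ) (f : EuclideanSpace ℝ (Fin 3) → ℂ) : Prop where
  continuous : Continuous f
  differentiableAt : ∀ x ∈ offCoordinatePlanes, DifferentiableAt ℝ f x
  norm_le : ∀ x ∈ offCoordinatePlanes, (∀ j, |x j| ≤ 1) → ‖f x‖ ≤ A
  norm_fderiv_le : ∀ x ∈ offCoordinatePlanes, (∀ j, |x j| ≤ 1) → ∀ v,
    ‖fderiv ℝ f x v‖ ≤ A * ∑ j, |v j| * |x j| ^ (c - 2)

/-- The point of the `c`-sphere over a point of the chart. -/
noncomputable def chartPoint (c : ℝ) (p : ℝ × ℝ) : EuclideanSpace ℝ (Fin 3) :=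
  !₂[p.1, p.2, chartHeight c p]

noncomputable def chartDensity (c : ℝ) (p : ℝ × ℝ) : ℝ := (1 - p.1 ^ c - p.2 ^ c) ^ (1 / c - 1)

lemma continuous_chartPoint {c : ℝ} (hc : 0 < c) : Continuous (chartPoint c) := by
  refine (PiLp.continuous_toLp 2 _).comp (continuous_pi fun j => ?_)
  fin_cases j
  · exact continuous_fst
  · exact continuous_snd
  · exact continuous_chartHeight hc

lemma measurable_chartDensity (c : ℝ) : Measurable (chartDensity c) := by
  unfold chartDensity
  fun_prop

namespace ChartLine

variable {c : ℝ} (L : ChartLine c)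

lemma hasDerivAt_chartPoint {r : ℝ} (hr : r ∈ Icc 0 L.R) :
    HasDerivAt (fun r => chartPoint c (L.x + r * L.s, L.y + r * L.t))
      !₂[L.s, L.t, -(L.m r * L.P r)] r := by
  have h : HasDerivAt (fun r => ![L.x + r * L.s, L.y + r * L.t, L.h r])
      ![L.s, L.t, -(L.m r * L.P r)] r := by
    rw [hasDerivAt_pi]
    intro j
    fin_cases j
    · exact L.hasDerivAt_fst r
    · exact L.hasDerivAt_snd r
    · exact L.hasDerivAt_h hr
  exact (PiLp.hasFDerivAt_toLp 2 _).comp_hasDerivAt r h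

lemma h_bounds {r : ℝ} (hr : r ∈ Icc 0 L.R) : 1 / 3 ≤ L.h r ∧ L.h r ≤ 1 := by
  have h1 := L.third_le_u hr
  have h2 := L.u_le_one hr
  have h3 := L.inv_c_bounds
  unfold h
  constructor
  · calc (1 : ℝ) / 3 ≤ L.u r ^ (1 : ℝ) := by rwa [Real.rpow_one]
      _ ≤ _ := Real.rpow_le_rpow_of_exponent_ge (L.u_pos hr) h2 h3.2.le
  · exact Real.rpow_le_one (L.u_pos hr).le h2 (by linarith)

lemma h_rpow_le {r : ℝ} (hr : r ∈ Icc 0 L.R) : L.h r ^ (c - 2) ≤ 3 := by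
  obtain ⟨h1, h2⟩ := L.h_bounds hr
  have h0 : 0 < L.h r := by linarith
  calc L.h r ^ (c - 2) ≤ L.h r ^ (-1 : ℝ) :=
        Real.rpow_le_rpow_of_exponent_ge h0 h2 (by linarith [L.one_lt])
    _ = (L.h r)⁻¹ := Real.rpow_neg_one _
    _ ≤ 3 := by rw [inv_le_comm₀ h0 (by norm_num)]; linarith

lemma chartPoint_mem {r : ℝ} (hr : r ∈ Ioc 0 L.R) :
    chartPoint c (L.x + r * L.s, L.y + r * L.t) ∈ offCoordinatePlanes ∧
      ∀ j, |chartPoint c (L.x + r * L.s, L.y + r * L.t) j| ≤ 1 := by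
  have hr' := L.Ioc_subset_Icc hr
  have hh := L.h_bounds hr'
  have e : chartHeight c (L.x + r * L.s, L.y + r * L.t) = L.h r := rfl
  constructor
  · intro j
    fin_cases j
    · exact (L.fst_pos r hr).ne'
    · exact (L.snd_pos r hr).ne'
    · change chartHeight c (L.x + r * L.s, L.y + r * L.t) ≠ 0
      rw [e]; linarith
  · intro j
    fin_cases j
    · change |L.x + r * L.s| ≤ 1
      exact abs_le.2 ⟨by linarith [L.fst_nonneg hr'], L.fst_le_one hr'⟩
    · change |L.y + r * L.t| ≤ 1
      exact abs_le.2 ⟨by linarith [L.snd_nonneg hr'], L.snd_le_one hr'⟩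
    · change |chartHeight c (L.x + r * L.s, L.y + r * L.t)| ≤ 1
      rw [e]; exact abs_le.2 ⟨by linarith, hh.2⟩

end ChartLine

/-- Chain rule along a line: the horizontal components give Q and the vertical one at most 9Q,
because h is bounded below. Multiplication by m ≤ 3 gives 30, and the derivative of the density adds
9. -/
lemma IsSphereSymbol.isChartAmplitude {c A : ℝ} {f : EuclideanSpace ℝ (Fin 3) → ℂ} (hc1 : 1 < c)
    (hc2 : c < 2) (hf : IsSphereSymbol c A f) :
    IsChartAmplitude c (39 * A) (fun p => f (chartPoint c p) * chartDensity c p) := by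
  have hc : 0 < c := by linarith
  have hline : ∀ L : ChartLine c, ∀ r ∈ Ioc 0 L.R,
      ‖f (chartPoint c (L.x + r * L.s, L.y + r * L.t)) *
        (chartDensity c (L.x + r * L.s, L.y + r * L.t) : ℂ)‖ ≤ 39 * A := by
    intro L r hr
    obtain ⟨h1, h2⟩ := L.chartPoint_mem hr
    have hm0 := L.one_le_m (L.Ioc_subset_Icc hr)
    have hm := L.m_le (L.Ioc_subset_Icc hr)
    have h3 := hf.norm_le _ h1 h2
    have hA := (norm_nonneg _).trans h3
    rw [norm_mul, Complex.norm_real, Real.norm_eq_abs,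
      show chartDensity c (L.x + r * L.s, L.y + r * L.t) = L.m r from rfl,
      abs_of_nonneg (by linarith)]
    calc _ ≤ A * 3 := mul_le_mul h3 hm (by linarith) hA
      _ ≤ 39 * A := by linarith
  refine ⟨?_, ?_, hline, ?_⟩
  · exact ((hf.continuous.comp (continuous_chartPoint hc)).measurable).mul
      (Complex.measurable_ofReal.comp (measurable_chartDensity c))
  · rintro ⟨x, y⟩ hp
    -- The constant line through a point turns the bound along lines into a pointwise one.
    have := hline (ChartLine.ofMem (x := x) (y := y) (s := 0) (t := 0) (R := 1) hc1 hc2 (by simp)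
      (by simp) one_pos one_le_two (chartRegion_subset c hp) (by simpa using hp)) 1 (by simp)
    simpa using this
  · intro L r hr
    have hr' := L.Ioc_subset_Icc hr
    obtain ⟨h1, h2⟩ := L.chartPoint_mem hr
    have hm0 := L.one_le_m hr'
    have hm := L.m_le hr'
    have hA := (norm_nonneg _).trans (hf.norm_le _ h1 h2)
    have hP := L.abs_P_le_Q hr
    have hQ : 0 ≤ L.Q r := (abs_nonneg _).trans hP
    have hd := ((hf.differentiableAt _ h1).hasFDerivAt.comp_hasDerivAt r
      (L.hasDerivAt_chartPoint hr')).mul (L.hasDerivAt_m hr').ofReal_comp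
    refine ⟨_, hd, ?_⟩
    have hn := hf.norm_fderiv_le _ h1 h2 !₂[L.s, L.t, -(L.m r * L.P r)]
    rw [Fin.sum_univ_three] at hn
    change _ ≤ A * (|L.s| * |L.x + r * L.s| ^ (c - 2) + |L.t| * |L.y + r * L.t| ^ (c - 2) +
      |-(L.m r * L.P r)| * |L.h r| ^ (c - 2)) at hn
    rw [abs_of_pos (L.fst_pos r hr), abs_of_pos (L.snd_pos r hr), abs_neg, abs_mul,
      abs_of_nonneg (by linarith : 0 ≤ L.m r),
      abs_of_nonneg (by linarith [(L.h_bounds hr').1] : 0 ≤ L.h r)] at hn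
    have e1 : L.m r * |L.P r| * L.h r ^ (c - 2) ≤ 3 * L.Q r * 3 := by
      have := L.h_rpow_le hr'
      have : 0 ≤ L.h r ^ (c - 2) := Real.rpow_nonneg (by linarith [(L.h_bounds hr').1]) _
      gcongr
    have e2 : A * (L.Q r + L.m r * |L.P r| * L.h r ^ (c - 2)) ≤ A * (10 * L.Q r) := by
      gcongr; linarith
    have e3 := (L.abs_m'_le hr').trans (mul_le_mul_of_nonneg_left hP (by norm_num))
    refine (norm_add_le _ _).trans ?_
    rw [norm_mul, norm_mul, Complex.norm_real, Complex.norm_real, Real.norm_eq_abs,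
      Real.norm_eq_abs, abs_of_nonneg (by linarith : 0 ≤ L.m r)]
    have f1 := mul_le_mul (hn.trans e2) hm (by linarith) (by positivity)
    have f2 := mul_le_mul (hf.norm_le _ h1 h2) e3 (abs_nonneg _) hA
    calc _ ≤ _ := add_le_add f1 f2
      _ = 39 * A * L.Q r := by ring

/-! ### Polar coordinates over the chart -/

lemma cNorm_eq_one_iff {c : ℝ} (hc : 0 < c) (w : EuclideanSpace ℝ (Fin 3)) :
    cNorm c w = 1 ↔ |w 0| ^ c + |w 1| ^ c + |w 2| ^ c = 1 := by
  have h : 0 ≤ |w 0| ^ c + |w 1| ^ c + |w 2| ^ c := by positivity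
  unfold cNorm
  rw [Fin.sum_univ_three]
  refine ⟨fun h' => ?_, fun h' => by rw [h', Real.one_rpow]⟩
  exact (Real.rpow_left_inj h zero_le_one (by positivity : 1 / c ≠ 0)).1
    (h'.trans (Real.one_rpow _).symm)

/-- The open cone over the chart. -/
def chartCone : Set (EuclideanSpace ℝ (Fin 3)) :=
  {x | 0 < x 0 ∧ 0 < x 1 ∧ x 0 < x 2 ∧ x 1 < x 2}

def cBall (c : ℝ) : Set (EuclideanSpace ℝ (Fin 3)) := {x | 0 < cNorm c x ∧ cNorm c x < 1}

lemma measurableSet_cBall (c : ℝ) : MeasurableSet (cBall c) :=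
  (measurableSet_lt measurable_const (measurable_cNorm c)).inter
    (measurableSet_lt (measurable_cNorm c) measurable_const)

section chart
variable {c : ℝ} {p : ℝ × ℝ}

lemma base_pos_of_mem (hp : p ∈ chartRegion c) : 0 < 1 - p.1 ^ c - p.2 ^ c := by
  obtain ⟨h1, h2, h3, h4⟩ := hp
  have := Real.rpow_pos_of_pos h1 c
  linarith

lemma chartHeight_pos (hp : p ∈ chartRegion c) : 0 < chartHeight c p :=
  Real.rpow_pos_of_pos (base_pos_of_mem hp) _

lemma chartHeight_rpow (hc : 0 < c) (hp : p ∈ chartRegion c) :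
    chartHeight c p ^ c = 1 - p.1 ^ c - p.2 ^ c := by
  rw [chartHeight, ← Real.rpow_mul (base_pos_of_mem hp).le, one_div_mul_cancel hc.ne',
    Real.rpow_one]

lemma cNorm_chartPoint (hc : 0 < c) (hp : p ∈ chartRegion c) : cNorm c (chartPoint c p) = 1 := by
  rw [cNorm_eq_one_iff hc]
  change |p.1| ^ c + |p.2| ^ c + |chartHeight c p| ^ c = 1
  rw [abs_of_pos hp.1, abs_of_pos hp.2.1, abs_of_pos (chartHeight_pos hp), chartHeight_rpow hc hp]
  ring

lemma chartPoint_mem_chartCone (hc : 0 < c) (hp : p ∈ chartRegion c) :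
    chartPoint c p ∈ chartCone := by
  have h := chartHeight_rpow hc hp
  have h0 := chartHeight_pos hp
  obtain ⟨h1, h2, h3, h4⟩ := hp
  refine ⟨h1, h2, ?_, ?_⟩
  · exact (Real.rpow_lt_rpow_iff h1.le h0.le hc).1 (by linarith)
  · exact (Real.rpow_lt_rpow_iff h2.le h0.le hc).1 (by linarith)

lemma exists_chartPoint_eq (hc : 0 < c) {w : EuclideanSpace ℝ (Fin 3)} (hw : cNorm c w = 1)
    (hw' : w ∈ chartCone) : (w 0, w 1) ∈ chartRegion c ∧ chartPoint c (w 0, w 1) = w := by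
  obtain ⟨h1, h2, h3, h4⟩ := hw'
  have h5 : 0 < w 2 := h1.trans h3
  rw [cNorm_eq_one_iff hc, abs_of_pos h1, abs_of_pos h2, abs_of_pos h5] at hw
  have h6 := Real.rpow_lt_rpow h1.le h3 hc
  have h7 := Real.rpow_lt_rpow h2.le h4 hc
  have hmem : (w 0, w 1) ∈ chartRegion c := by
    refine ⟨h1, h2, ?_, ?_⟩ <;> simp only <;> linarith
  refine ⟨hmem, ?_⟩
  ext j
  fin_cases j
  · rfl
  · rfl
  · change (1 - w 0 ^ c - w 1 ^ c) ^ (1 / c) = w 2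
    rw [show 1 - w 0 ^ c - w 1 ^ c = w 2 ^ c by linarith, ← Real.rpow_mul h5.le,
      mul_one_div_cancel hc.ne', Real.rpow_one]

/-- Polar coordinates over the chart. -/
noncomputable def conePolar (c : ℝ) (q : Fin 3 → ℝ) : Fin 3 → ℝ :=
  ![q 2 * q 0, q 2 * q 1, q 2 * chartHeight c (q 0, q 1)]

def conePolarSource (c : ℝ) : Set (Fin 3 → ℝ) :=
  {q | (q 0, q 1) ∈ chartRegion c ∧ q 2 ∈ Ioo (0 : ℝ) 1}

lemma toLp_conePolar (c : ℝ) (q : Fin 3 → ℝ) :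
    WithLp.toLp 2 (conePolar c q) = q 2 • chartPoint c (q 0, q 1) := by
  ext j
  fin_cases j <;> rfl

lemma smul_mem_chartCone {t : ℝ} (ht : 0 < t) {x : EuclideanSpace ℝ (Fin 3)}
    (hx : x ∈ chartCone) : t • x ∈ chartCone := by
  obtain ⟨h1, h2, h3, h4⟩ := hx
  simp only [chartCone, mem_ofPred_eq, PiLp.smul_apply, smul_eq_mul]
  exact ⟨mul_pos ht h1, mul_pos ht h2, mul_lt_mul_of_pos_left h3 ht, mul_lt_mul_of_pos_left h4 ht⟩

lemma cNorm_toLp_conePolar (hc : 0 < c) {q : Fin 3 → ℝ} (hq : q ∈ conePolarSource c) :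
    cNorm c (WithLp.toLp 2 (conePolar c q)) = q 2 := by
  rw [toLp_conePolar, cNorm_smul hc hq.2.1.le, cNorm_chartPoint hc hq.1, mul_one]

lemma injOn_conePolar (hc : 0 < c) : InjOn (conePolar c) (conePolarSource c) := by
  intro q hq q' hq' h
  have h2 : q 2 = q' 2 := by
    rw [← cNorm_toLp_conePolar hc hq, h, cNorm_toLp_conePolar hc hq']
  have h0 : q 2 * q 0 = q' 2 * q' 0 := congrFun h 0
  have h1 : q 2 * q 1 = q' 2 * q' 1 := congrFun h 1
  rw [← h2] at h0 h1
  ext j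
  fin_cases j
  · exact mul_left_cancel₀ hq.2.1.ne' h0
  · exact mul_left_cancel₀ hq.2.1.ne' h1
  · exact h2

lemma image_conePolar (hc : 0 < c) : conePolar c '' conePolarSource c =
    WithLp.toLp 2 ⁻¹' (chartCone ∩ cBall c) := by
  ext v
  constructor
  · rintro ⟨q, hq, rfl⟩
    have h := cNorm_toLp_conePolar hc hq
    refine ⟨?_, ?_⟩
    · rw [toLp_conePolar]
      exact smul_mem_chartCone hq.2.1 (chartPoint_mem_chartCone hc hq.1)
    · change 0 < cNorm c _ ∧ cNorm c _ < 1
      rw [h]; exact hq.2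
  · rintro ⟨hv, hv0, hv1⟩
    set x : EuclideanSpace ℝ (Fin 3) := WithLp.toLp 2 v with hx
    set r := cNorm c x with hr
    have hw : cNorm c (r⁻¹ • x) = 1 := by
      rw [cNorm_smul hc (by positivity), inv_mul_cancel₀ hv0.ne']
    obtain ⟨g1, g2⟩ := exists_chartPoint_eq hc hw (smul_mem_chartCone (by positivity) hv)
    refine ⟨![(r⁻¹ • x) 0, (r⁻¹ • x) 1, r], ⟨g1, hv0, hv1⟩, ?_⟩
    apply (WithLp.toLp_injective 2)
    rw [toLp_conePolar]
    change r • chartPoint c ((r⁻¹ • x) 0, (r⁻¹ • x) 1) = x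
    rw [g2, smul_smul, mul_inv_cancel₀ hv0.ne', one_smul]

/-- The Jacobian matrix of `conePolar`. -/
noncomputable def conePolarMatrix (c : ℝ) (q : Fin 3 → ℝ) : Matrix (Fin 3) (Fin 3) ℝ :=
  !![q 2, 0, q 0; 0, q 2, q 1;
    -(q 2 * chartDensity c (q 0, q 1) * q 0 ^ (c - 1)),
    -(q 2 * chartDensity c (q 0, q 1) * q 1 ^ (c - 1)), chartHeight c (q 0, q 1)]

lemma chartHeight_eq (hp : p ∈ chartRegion c) :
    chartHeight c p = chartDensity c p * (1 - p.1 ^ c - p.2 ^ c) := by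
  rw [chartDensity, Real.rpow_sub_one (base_pos_of_mem hp).ne',
    div_mul_cancel₀ _ (base_pos_of_mem hp).ne', chartHeight]

/-- Expanding gives r²(h + m(x^c + y^c)) with m the density and r = q 2. Since h = m(1 - x^c - y^c),
the bracket collapses to m. -/
lemma det_conePolarMatrix {q : Fin 3 → ℝ} (hq : q ∈ conePolarSource c) :
    (conePolarMatrix c q).det = q 2 ^ 2 * chartDensity c (q 0, q 1) := by
  have h1 : 0 < q 0 := hq.1.1
  have h2 : 0 < q 1 := hq.1.2.1
  rw [conePolarMatrix, Matrix.det_fin_three]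
  simp only [Matrix.of_apply, Matrix.cons_val', Matrix.cons_val_zero, Matrix.cons_val_one,
    Matrix.cons_val, Matrix.cons_val_fin_one]
  rw [chartHeight_eq hq.1, Real.rpow_sub_one h1.ne', Real.rpow_sub_one h2.ne']
  field_simp
  ring

lemma hasFDerivAt_conePolar (hc : 1 < c) {q : Fin 3 → ℝ} (hq : q ∈ conePolarSource c) :
    HasFDerivAt (conePolar c) (Matrix.toLin' (conePolarMatrix c q)).toContinuousLinearMap q := by
  have hc0 : 0 < c := by linarith
  have d : ∀ j, HasFDerivAt (fun q : Fin 3 → ℝ => q j)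
      (ContinuousLinearMap.proj (R := ℝ) (φ := fun _ : Fin 3 => ℝ) j) q :=
    fun j => (ContinuousLinearMap.proj (R := ℝ) (φ := fun _ : Fin 3 => ℝ) j).hasFDerivAt
  have dH := ((((d 0).rpow_const (p := c) (Or.inr hc.le)).const_sub 1).sub
    ((d 1).rpow_const (p := c) (Or.inr hc.le))).rpow_const (p := 1 / c)
    (Or.inl (base_pos_of_mem hq.1).ne')
  rw [hasFDerivAt_pi']
  intro j
  fin_cases j
  · refine ((d 2).mul (d 0)).congr_fderiv ?_
    ext v
    simp [conePolarMatrix, Matrix.toLin'_apply, dotProduct, Fin.sum_univ_three]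
  · refine ((d 2).mul (d 1)).congr_fderiv ?_
    ext v
    simp [conePolarMatrix, Matrix.toLin'_apply, dotProduct, Fin.sum_univ_three]
  · refine ((d 2).mul dH).congr_fderiv ?_
    ext v
    simp [conePolarMatrix, Matrix.toLin'_apply, dotProduct, Fin.sum_univ_three,
      chartHeight, chartDensity]
    field_simp
    ring

end chart

/-- The measurable equivalence `q ↦ (q₂, (q₀, q₁))`. -/
noncomputable def finThreeEquiv : (Fin 3 → ℝ) ≃ᵐ ℝ × ℝ × ℝ :=
  (MeasurableEquiv.piFinSuccAbove (fun _ : Fin 3 => ℝ) 2).trans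
    ((MeasurableEquiv.refl ℝ).prodCongr MeasurableEquiv.finTwoArrow)

lemma finThreeEquiv_apply (q : Fin 3 → ℝ) : finThreeEquiv q = (q 2, (q 0, q 1)) := rfl

lemma measurePreserving_finThreeEquiv : MeasurePreserving finThreeEquiv :=
  ((MeasurePreserving.id volume).prod (volume_preserving_finTwoArrow ℝ)).comp
    (volume_preserving_piFinSuccAbove (fun _ : Fin 3 => ℝ) 2)

/-- The integral over a cone in polar coordinates. -/
theorem setIntegral_chartCone {c : ℝ} (hc : 1 < c) (G : EuclideanSpace ℝ (Fin 3) → ℂ) :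
    ∫ x in chartCone ∩ cBall c, G ((cNorm c x)⁻¹ • x) =
      (1 / 3) * ∫ p in chartRegion c, chartDensity c p * G (chartPoint c p) := by
  have hc0 : 0 < c := by linarith
  have hsrc : conePolarSource c = finThreeEquiv ⁻¹' (Ioo (0 : ℝ) 1 ×ˢ chartRegion c) := by
    ext q
    simp only [conePolarSource, mem_preimage, finThreeEquiv_apply, mem_prod, mem_ofPred_eq]
    tauto
  have hms : MeasurableSet (conePolarSource c) := by
    rw [hsrc]
    exact finThreeEquiv.measurable
      (measurableSet_Ioo.prod (isOpen_chartRegion hc0).measurableSet)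
  have h1 := (EuclideanSpace.volume_preserving_symm_measurableEquiv_toLp (Fin 3)).symm
  have h1' : MeasurePreserving (WithLp.toLp 2 : (Fin 3 → ℝ) → EuclideanSpace ℝ (Fin 3)) := h1
  have hemb : MeasurableEmbedding (WithLp.toLp 2 : (Fin 3 → ℝ) → EuclideanSpace ℝ (Fin 3)) :=
    (MeasurableEquiv.toLp 2 (Fin 3 → ℝ)).measurableEmbedding
  rw [← h1'.setIntegral_preimage_emb hemb (fun x => G ((cNorm c x)⁻¹ • x)),
    ← image_conePolar hc0, integral_image_eq_integral_abs_det_fderiv_smul volume hms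
    (fun q hq => (hasFDerivAt_conePolar hc hq).hasFDerivWithinAt) (injOn_conePolar hc0)]
  have h2 : ∫ q in conePolarSource c,
      |((Matrix.toLin' (conePolarMatrix c q)).toContinuousLinearMap).det| •
        G ((cNorm c (WithLp.toLp 2 (conePolar c q)))⁻¹ • WithLp.toLp 2 (conePolar c q)) =
      ∫ q in conePolarSource c, (fun z : ℝ × ℝ × ℝ => ((z.1 ^ 2 : ℝ) : ℂ) *
        (chartDensity c z.2 * G (chartPoint c z.2))) (finThreeEquiv q) := by
    refine setIntegral_congr_fun hms fun q hq => ?_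
    have e1 : ((Matrix.toLin' (conePolarMatrix c q)).toContinuousLinearMap).det =
        q 2 ^ 2 * chartDensity c (q 0, q 1) := by
      rw [← det_conePolarMatrix hq, ← LinearMap.det_toLin']; rfl
    have e2 : 0 < chartDensity c (q 0, q 1) := Real.rpow_pos_of_pos (base_pos_of_mem hq.1) _
    simp only
    rw [e1, cNorm_toLp_conePolar hc0 hq, toLp_conePolar, smul_smul, inv_mul_cancel₀ hq.2.1.ne',
      one_smul, abs_of_nonneg (by positivity), finThreeEquiv_apply, Complex.real_smul,
      Complex.ofReal_mul, mul_assoc]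
  rw [h2, hsrc, measurePreserving_finThreeEquiv.setIntegral_preimage_emb
    finThreeEquiv.measurableEmbedding (fun z : ℝ × ℝ × ℝ => ((z.1 ^ 2 : ℝ) : ℂ) *
        (chartDensity c z.2 * G (chartPoint c z.2))), Measure.volume_eq_prod]
  rw [setIntegral_prod_mul (fun r : ℝ => ((r ^ 2 : ℝ) : ℂ))
    (fun p => (chartDensity c p : ℂ) * G (chartPoint c p))]
  -- The factor 1/3 is the radial integral of r² over (0,1); it will cancel the 3 in the definition
  -- of μ_c.
  congr 1
  rw [integral_complex_ofReal, ← integral_Ioc_eq_integral_Ioo,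
    ← intervalIntegral.integral_of_le zero_le_one, integral_pow]
  norm_num

/-! ### Decay for a single cone -/

lemma norm_le_sum_abs (ξ : EuclideanSpace ℝ (Fin 3)) : ‖ξ‖ ≤ |ξ 0| + |ξ 1| + |ξ 2| := by
  rw [EuclideanSpace.norm_eq, Fin.sum_univ_three]
  refine Real.sqrt_le_iff.2 ⟨by positivity, ?_⟩
  simp only [Real.norm_eq_abs]
  nlinarith [abs_nonneg (ξ 0), abs_nonneg (ξ 1), abs_nonneg (ξ 2),
    mul_nonneg (abs_nonneg (ξ 0)) (abs_nonneg (ξ 1)),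
    mul_nonneg (abs_nonneg (ξ 0)) (abs_nonneg (ξ 2)),
    mul_nonneg (abs_nonneg (ξ 1)) (abs_nonneg (ξ 2))]

/-- The free sign S allows the coefficient of the height to be made positive, that is, the phase to
be made convex. -/
lemma expTwoPiI_chartPoint {S : ℝ} (hS : S * S = 1) (c : ℝ) (ξ : EuclideanSpace ℝ (Fin 3))
    (p : ℝ × ℝ) : expTwoPiI (-inner ℝ (chartPoint c p) ξ) =
      Complex.exp (Complex.I * (S * chartPhase c (S * (-(2 * Real.pi * ξ 0)))
        (S * (-(2 * Real.pi * ξ 1))) (S * (2 * Real.pi * ξ 2)) p)) := by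
  have h1 : inner ℝ (chartPoint c p) ξ = p.1 * ξ 0 + p.2 * ξ 1 + chartHeight c p * ξ 2 := by
    rw [PiLp.inner_apply, Fin.sum_univ_three]
    simp only [RCLike.inner_apply, conj_trivial]
    change ξ 0 * p.1 + ξ 1 * p.2 + ξ 2 * chartHeight c p = _
    ring
  have h2 : S * chartPhase c (S * (-(2 * Real.pi * ξ 0)))
      (S * (-(2 * Real.pi * ξ 1))) (S * (2 * Real.pi * ξ 2)) p =
      2 * Real.pi * (-(p.1 * ξ 0 + p.2 * ξ 1 + chartHeight c p * ξ 2)) := by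
    unfold chartPhase
    linear_combination (-(2 * Real.pi * (p.1 * ξ 0 + p.2 * ξ 1 + chartHeight c p * ξ 2))) * hS
  rw [expTwoPiI, h1, ← Complex.ofReal_mul S, h2]
  push_cast
  ring_nf

/-- The decay constant of a single chart. -/
noncomputable def chartConst (c : ℝ) : ℝ := 5 * (1423 / (c - 1) ^ 2 * 39)

theorem IsSphereSymbol.norm_setIntegral_chartCone_le {c A : ℝ} (hc1 : 1 < c) (hc2 : c < 2)
    {f : EuclideanSpace ℝ (Fin 3) → ℂ} (hf : IsSphereSymbol c A f)
    (ξ : EuclideanSpace ℝ (Fin 3)) :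
    ‖∫ x in chartCone ∩ cBall c, f ((cNorm c x)⁻¹ • x) *
      expTwoPiI (-inner ℝ ((cNorm c x)⁻¹ • x) ξ)‖ * ‖ξ‖ ≤ chartConst c * A := by
  have hb := hf.isChartAmplitude hc1 hc2
  have hA : 0 ≤ A := by linarith [hb.nonneg hc1]
  have hc0 : 0 < c - 1 := by linarith
  have hpi := Real.pi_pos
  set K := 1423 / (c - 1) ^ 2 * 39 with hK
  have hK0 : 0 ≤ K := by positivity
  rw [setIntegral_chartCone hc1 (fun w => f w * expTwoPiI (-inner ℝ w ξ))]
  set J := ∫ p in chartRegion c, (chartDensity c p : ℂ) *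
    (f (chartPoint c p) * expTwoPiI (-inner ℝ (chartPoint c p) ξ)) with hJ
  have hJS : ∀ S : ℝ, S * S = 1 → J = ∫ p in chartRegion c,
      chartIntegrand c S (S * (-(2 * Real.pi * ξ 0))) (S * (-(2 * Real.pi * ξ 1)))
        (S * (2 * Real.pi * ξ 2)) (fun p => f (chartPoint c p) * chartDensity c p) p := by
    intro S hS
    rw [hJ]
    congr 1
    ext p
    rw [expTwoPiI_chartPoint hS, chartIntegrand]
    ring
  -- It suffices to gain 1/|ξ j| for one coordinate comparable to ‖ξ‖; the 5 = 1 + 2 + 2 occurs when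
  -- j = 2.
  have key : ∀ j : Fin 3, ξ j ≠ 0 → ‖ξ‖ ≤ 5 * |ξ j| → ‖J‖ ≤ K * A / |ξ j| →
      ‖(1 / 3 : ℂ) * J‖ * ‖ξ‖ ≤ chartConst c * A := by
    intro j hj h1 h2
    have h3 : 0 < |ξ j| := abs_pos.2 hj
    have h4 : ‖(1 / 3 : ℂ) * J‖ ≤ ‖J‖ := by
      rw [norm_mul]
      exact mul_le_of_le_one_left (norm_nonneg _) (by norm_num)
    calc ‖(1 / 3 : ℂ) * J‖ * ‖ξ‖ ≤ (K * A / |ξ j|) * (5 * |ξ j|) :=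
          mul_le_mul (h4.trans h2) h1 (norm_nonneg _) (by positivity)
      _ = chartConst c * A := by rw [chartConst, ← hK]; field_simp
  have hn := norm_le_sum_abs ξ
  have htrans : ∀ z : ℝ, z ≠ 0 → 16 / (c - 1) * (39 * A) / |1 * (-(2 * Real.pi * z))| ≤
      K * A / |z| := by
    intro z hz
    have hz0 := abs_pos.2 hz
    have e1 : |1 * (-(2 * Real.pi * z))| = 2 * Real.pi * |z| := by
      rw [one_mul, abs_neg, abs_mul, abs_of_pos (by positivity)]
    rw [e1]
    calc 16 / (c - 1) * (39 * A) / (2 * Real.pi * |z|) ≤ 16 / (c - 1) * (39 * A) / (1 * |z|) := by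
          gcongr; linarith [Real.pi_gt_three]
      _ ≤ K * A / |z| := by
          rw [one_mul, ← mul_assoc]
          gcongr
          rw [hK]
          gcongr ?_ * _
          rw [div_le_div_iff₀ hc0 (by positivity)]
          nlinarith
  -- Either the third frequency controls the others and the estimate about a minimum applies, or the
  -- larger horizontal frequency is at least twice the third and the transversal estimate applies.
  by_cases hA0 : |ξ 0| ≤ 2 * |ξ 2| ∧ |ξ 1| ≤ 2 * |ξ 2|
  · by_cases h2 : ξ 2 = 0
    · have : ‖ξ‖ = 0 := by
        rw [h2, abs_zero] at hA0 hn
        exact le_antisymm (by linarith [hA0.1, hA0.2]) (norm_nonneg _)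
      rw [this, mul_zero, chartConst]; positivity
    · refine key 2 h2 (by linarith [hA0.1, hA0.2]) ?_
      have hz0 := abs_pos.2 h2
      -- The 2π from the angular integration cancels that in σ.
      have fin : ∀ σ, σ = 2 * Real.pi * |ξ 2| →
          2 * Real.pi * (1423 / (c - 1) ^ 2 * (39 * A) / σ) = K * A / |ξ 2| := by
        rintro σ rfl
        rw [hK]; field_simp
      rcases lt_or_gt_of_ne h2 with h | h
      · rw [hJS (-1) (by norm_num)]
        refine (hb.norm_integral_le hc1 hc2 (by norm_num) (by nlinarith)).trans (le_of_eq ?_)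
        exact fin _ (by rw [abs_of_neg h]; ring)
      · rw [hJS 1 (by norm_num)]
        refine (hb.norm_integral_le hc1 hc2 (by norm_num) (by positivity)).trans (le_of_eq ?_)
        exact fin _ (by rw [abs_of_pos h]; ring)
  · have hτ : ∀ z : ℝ, 2 * |ξ 2| ≤ |z| →
        2 * |1 * (2 * Real.pi * ξ 2)| ≤ |1 * (-(2 * Real.pi * z))| := by
      intro z hz
      rw [one_mul, one_mul, abs_neg, abs_mul, abs_mul _ z, abs_of_pos (by positivity)]
      nlinarith
    rcases le_total |ξ 1| |ξ 0| with h | h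
    · have h0 : 2 * |ξ 2| ≤ |ξ 0| := by
        by_contra! h'
        exact hA0 ⟨h'.le, by linarith⟩
      have hne : ξ 0 ≠ 0 := by
        intro h'
        rw [h', abs_zero] at h0 h
        exact hA0 ⟨by rw [h', abs_zero]; positivity, h.trans (by positivity)⟩
      refine key 0 hne (by linarith [abs_nonneg (ξ 2)]) ?_
      rw [hJS 1 (by norm_num)]
      exact (hb.norm_integral_le_fst hc1 hc2 (by norm_num)
        (by simp [hne, hpi.ne']) (hτ _ h0)).trans (htrans _ hne)
    · have h0 : 2 * |ξ 2| ≤ |ξ 1| := by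
        by_contra! h'
        exact hA0 ⟨by linarith, h'.le⟩
      have hne : ξ 1 ≠ 0 := by
        intro h'
        rw [h', abs_zero] at h0 h
        exact hA0 ⟨h.trans (by positivity), by rw [h', abs_zero]; positivity⟩
      refine key 1 hne (by linarith [abs_nonneg (ξ 2)]) ?_
      rw [hJS 1 (by norm_num)]
      exact (hb.norm_integral_le_snd hc1 hc2 (by norm_num)
        (by simp [hne, hpi.ne']) (hτ _ h0)).trans (htrans _ hne)

/-! ### Symmetries: the 24 signed cones -/

/-- The sign `1` or `-1`. -/
noncomputable def boolSign (b : Bool) : ℝ := if b then 1 else -1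

lemma abs_boolSign (b : Bool) : |boolSign b| = 1 := by cases b <;> simp [boolSign]

/-- The isometry with `(T x) j = ε_j x_{τ j}`, where `τ` is the transposition of `k` and `2`. -/
noncomputable def signedSwap (i : (Fin 3 → Bool) × Fin 3) : E3 ≃ₗᵢ[ℝ] E3 :=
  (LinearIsometryEquiv.piLpCongrLeft 2 ℝ ℝ (Equiv.swap i.2 2)).trans
    (LinearIsometryEquiv.piLpCongrRight 2 fun j =>
      if i.1 j then LinearIsometryEquiv.refl ℝ ℝ else LinearIsometryEquiv.neg ℝ)

lemma signedSwap_apply (i : (Fin 3 → Bool) × Fin 3) (x : E3) (j : Fin 3) :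
    signedSwap i x j = boolSign (i.1 j) * x (Equiv.swap i.2 2 j) := by
  simp only [signedSwap, boolSign, LinearIsometryEquiv.trans_apply,
    LinearIsometryEquiv.piLpCongrRight_apply, LinearIsometryEquiv.piLpCongrLeft_apply]
  by_cases h : i.1 j <;> simp [h, Equiv.piCongrLeft']

lemma abs_signedSwap_apply (i : (Fin 3 → Bool) × Fin 3) (x : E3) (j : Fin 3) :
    |signedSwap i x j| = |x (Equiv.swap i.2 2 j)| := by
  rw [signedSwap_apply, abs_mul, abs_boolSign, one_mul]

lemma cNorm_signedSwap (c : ℝ) (i : (Fin 3 → Bool) × Fin 3) (x : E3) :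
    cNorm c (signedSwap i x) = cNorm c x := by
  unfold cNorm
  simp_rw [abs_signedSwap_apply]
  rw [Equiv.sum_comp (Equiv.swap i.2 2) (fun j => |x j| ^ c)]

lemma IsSphereSymbol.comp_signedSwap {c A : ℝ} {f : E3 → ℂ} (hf : IsSphereSymbol c A f)
    (i : (Fin 3 → Bool) × Fin 3) : IsSphereSymbol c A (fun x => f (signedSwap i x)) := by
  have hoff : ∀ x ∈ offCoordinatePlanes, signedSwap i x ∈ offCoordinatePlanes := fun x hx j => by
    rw [← abs_pos, abs_signedSwap_apply, abs_pos]; exact hx _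
  have hle : ∀ x : E3, (∀ j, |x j| ≤ 1) → ∀ j, |signedSwap i x j| ≤ 1 := fun x hx j => by
    rw [abs_signedSwap_apply]; exact hx _
  refine ⟨hf.continuous.comp (signedSwap i).continuous, fun x hx => ?_,
    fun x hx h => hf.norm_le _ (hoff x hx) (hle x h), fun x hx h v => ?_⟩
  · exact (hf.differentiableAt _ (hoff x hx)).comp x (signedSwap i).differentiableAt
  · have e : fderiv ℝ (fun x => f (signedSwap i x)) x v =
        fderiv ℝ f (signedSwap i x) (signedSwap i v) := by
      have := ((hf.differentiableAt _ (hoff x hx)).hasFDerivAt.comp x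
        (signedSwap i).hasFDerivAt).fderiv
      exact congrArg (fun D : E3 →L[ℝ] ℂ => D v) this
    rw [e]
    refine (hf.norm_fderiv_le _ (hoff x hx) (hle x h) _).trans (le_of_eq ?_)
    simp_rw [abs_signedSwap_apply]
    rw [Equiv.sum_comp (Equiv.swap i.2 2) (fun j => |v j| * |x j| ^ (c - 2))]

/-- The image of the chart cone under a signed transposition. -/
def signedCone (i : (Fin 3 → Bool) × Fin 3) : Set E3 := (signedSwap i).symm ⁻¹' chartCone

/-- In this form the cone can be read off from the point: the signs of its coordinates and the index
of the largest modulus. Disjointness and almost everywhere covering follow at once. -/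
lemma mem_signedCone_iff (i : (Fin 3 → Bool) × Fin 3) (y : E3) : y ∈ signedCone i ↔
    (∀ j, 0 < boolSign (i.1 j) * y j) ∧
      ∀ j, j ≠ i.2 → boolSign (i.1 j) * y j < boolSign (i.1 i.2) * y i.2 := by
  obtain ⟨x, rfl⟩ := (signedSwap i).surjective y
  have hs : ∀ j, boolSign (i.1 j) * signedSwap i x j = x (Equiv.swap i.2 2 j) := fun j => by
    rw [signedSwap_apply, ← mul_assoc, ← abs_mul_abs_self, abs_boolSign, one_mul, one_mul]
  simp_rw [hs]
  rw [Equiv.swap_apply_left, signedCone, mem_preimage, LinearIsometryEquiv.symm_apply_apply]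
  obtain ⟨e, k⟩ := i
  constructor
  · rintro ⟨h1, h2, h3, h4⟩
    constructor
    · intro j
      generalize Equiv.swap k 2 j = l
      fin_cases l
      · exact h1
      · exact h2
      · exact h1.trans h3
    · intro j hj
      have : Equiv.swap k 2 j ≠ 2 := fun h => hj (by
        exact (Equiv.swap k 2).injective (h.trans (Equiv.swap_apply_left k 2).symm))
      revert this
      generalize Equiv.swap k 2 j = l
      intro hl
      fin_cases l
      · exact h3
      · exact h4
      · exact absurd rfl hl
  · rintro ⟨h1, h2⟩
    have g1 : ∀ l, 0 < x l := fun l => by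
      simpa using h1 (Equiv.swap k 2 l)
    have g2 : ∀ l, l ≠ 2 → x l < x 2 := fun l hl => by
      simpa using h2 (Equiv.swap k 2 l) (fun h => hl (by
        exact (Equiv.swap k 2).injective (h.trans (Equiv.swap_apply_right k 2).symm)))
    exact ⟨g1 0, g1 1, g2 0 (by decide), g2 1 (by decide)⟩

lemma eq_of_boolSign_mul_pos {a b : Bool} {z : ℝ} (ha : 0 < boolSign a * z)
    (hb : 0 < boolSign b * z) : a = b := by
  cases a <;> cases b <;> simp [boolSign] at * <;> linarith

lemma pairwise_disjoint_signedCone : Pairwise (Function.onFun Disjoint signedCone) := by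
  rintro ⟨e, k⟩ ⟨e', k'⟩ hne
  rw [Function.onFun, Set.disjoint_left]
  intro y hy hy'
  rw [mem_signedCone_iff] at hy hy'
  obtain ⟨h1, h2⟩ := hy
  obtain ⟨h1', h2'⟩ := hy'
  have he : e = e' := funext fun j => eq_of_boolSign_mul_pos (h1 j) (h1' j)
  subst he
  by_cases hk : k = k'
  · exact hne (by rw [hk])
  · exact lt_asymm (h2 k' (Ne.symm hk)) (h2' k hk)

lemma isOpen_chartCone : IsOpen chartCone := by
  have h : ∀ j : Fin 3, Continuous fun x : E3 => x j := fun j => by fun_prop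
  exact (isOpen_lt continuous_const (h 0)).inter ((isOpen_lt continuous_const (h 1)).inter
    ((isOpen_lt (h 0) (h 2)).inter (isOpen_lt (h 1) (h 2))))

lemma measurableSet_signedCone (i : (Fin 3 → Bool) × Fin 3) : MeasurableSet (signedCone i) :=
  (isOpen_chartCone.preimage (signedSwap i).symm.continuous).measurableSet

/-- The kernel is a proper subspace, hence a null set. -/
lemma ae_apply_ne_zero {φ : E3 →ₗ[ℝ] ℝ} (hφ : φ ≠ 0) : ∀ᵐ x, φ x ≠ 0 := by
  have := Measure.addHaar_submodule volume (LinearMap.ker φ)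
    (fun h => hφ (LinearMap.ker_eq_top.1 h))
  exact measure_eq_zero_iff_ae_notMem.1 this

lemma ae_coord_ne_zero : ∀ᵐ x : E3, x ∈ offCoordinatePlanes := by
  refine ae_all_iff.2 fun j => ?_
  exact ae_apply_ne_zero (φ := (EuclideanSpace.proj j : E3 →L[ℝ] ℝ).toLinearMap) (fun h => by
    have := LinearMap.congr_fun h (EuclideanSpace.single j 1)
    simp at this)

lemma ae_abs_ne_abs {j k : Fin 3} (hjk : j ≠ k) : ∀ᵐ x : E3, |x j| ≠ |x k| := by
  have h1 := ae_apply_ne_zero (φ := (EuclideanSpace.proj j : E3 →L[ℝ] ℝ).toLinearMap -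
    (EuclideanSpace.proj k : E3 →L[ℝ] ℝ).toLinearMap) (fun h => by
      have := LinearMap.congr_fun h (EuclideanSpace.single j 1)
      simp [hjk.symm] at this)
  have h2 := ae_apply_ne_zero (φ := (EuclideanSpace.proj j : E3 →L[ℝ] ℝ).toLinearMap +
    (EuclideanSpace.proj k : E3 →L[ℝ] ℝ).toLinearMap) (fun h => by
      have := LinearMap.congr_fun h (EuclideanSpace.single j 1)
      simp [hjk.symm] at this)
  filter_upwards [h1, h2] with x hx hx' h
  rcases abs_eq_abs.1 h with h | h
  · exact hx (by simp [h])
  · exact hx' (by simp [h])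

/-- Off the null sets x_j = 0 and |x_j| = |x_k| the largest modulus is attained at a single index,
and all signs are determined. -/
lemma ae_mem_iUnion_signedCone : ∀ᵐ x : E3, x ∈ ⋃ i, signedCone i := by
  have h : ∀ᵐ x : E3, ∀ j k : Fin 3, j ≠ k → |x j| ≠ |x k| := by
    refine ae_all_iff.2 fun j => ae_all_iff.2 fun k => ?_
    by_cases hjk : j = k
    · exact Eventually.of_forall fun x h => absurd hjk h
    · filter_upwards [ae_abs_ne_abs hjk] with x hx _ using hx
  filter_upwards [ae_coord_ne_zero, h] with x hx hne
  obtain ⟨k, -, hk⟩ := Finset.exists_max_image Finset.univ (fun j => |x j|) ⟨0, Finset.mem_univ _⟩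
  have hsgn : ∀ j, boolSign (decide (0 < x j)) * x j = |x j| := fun j => by
    by_cases h : 0 < x j
    · simp [boolSign, h, abs_of_pos h]
    · simp [boolSign, h, abs_of_nonpos (not_lt.1 h)]
  refine mem_iUnion.2 ⟨(fun j => decide (0 < x j), k), ?_⟩
  rw [mem_signedCone_iff]
  simp only [hsgn]
  exact ⟨fun j => abs_pos.2 (hx j), fun j hj => lt_of_le_of_ne (hk j (Finset.mem_univ _)) (hne j k hj)⟩

/-! ### Summing over the cones -/

lemma abs_apply_le_cNorm {c : ℝ} (hc : 0 < c) (x : E3) (j : Fin 3) : |x j| ≤ cNorm c x := by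
  unfold cNorm
  have h1 : |x j| ^ c ≤ ∑ j, |x j| ^ c :=
    Finset.single_le_sum (f := fun j => |x j| ^ c) (fun i _ => by positivity) (Finset.mem_univ j)
  have h2 := Real.rpow_le_rpow (by positivity) h1 (by positivity : 0 ≤ 1 / c)
  rwa [← Real.rpow_mul (abs_nonneg _), mul_one_div_cancel hc.ne', Real.rpow_one] at h2

lemma volume_cBall_lt_top {c : ℝ} (hc : 0 < c) : volume (cBall c) < ⊤ := by
  have hsub : cBall c ⊆ Metric.closedBall 0 3 := fun x hx => by
    rw [mem_closedBall_zero_iff]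
    have h := fun j => (abs_apply_le_cNorm hc x j).trans hx.2.le
    linarith [norm_le_sum_abs x, h 0, h 1, h 2]
  exact (measure_mono hsub).trans_lt (isCompact_closedBall _ _).measure_lt_top

section
variable {c A : ℝ} {f : E3 → ℂ}

lemma norm_expTwoPiI (t : ℝ) : ‖expTwoPiI t‖ = 1 := by
  have := Complex.norm_exp_ofReal_mul_I (2 * Real.pi * t)
  rw [expTwoPiI, ← this]
  congr 2
  push_cast
  ring

lemma continuous_expTwoPiI_inner (ξ : E3) : Continuous fun w : E3 => expTwoPiI (-inner ℝ w ξ) := by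
  unfold expTwoPiI
  fun_prop

lemma IsSphereSymbol.ae_norm_le (hc : 0 < c) (hf : IsSphereSymbol c A f) (ξ : E3) :
    ∀ᵐ x : E3, ‖f ((cNorm c x)⁻¹ • x) * expTwoPiI (-inner ℝ ((cNorm c x)⁻¹ • x) ξ)‖ ≤ A := by
  filter_upwards [ae_coord_ne_zero] with x hx
  have h0 : 0 < cNorm c x := cNorm_pos fun h => hx 0 (by simp [h])
  rw [norm_mul, norm_expTwoPiI, mul_one]
  refine hf.norm_le _ (fun j => ?_) (fun j => ?_)
  · rw [PiLp.smul_apply, smul_eq_mul]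
    exact mul_ne_zero (by positivity) (hx j)
  · refine (abs_apply_le_cNorm hc _ j).trans (le_of_eq ?_)
    rw [cNorm_smul hc (by positivity), inv_mul_cancel₀ h0.ne']

lemma IsSphereSymbol.measurable_integrand (hf : IsSphereSymbol c A f) (ξ : E3) :
    Measurable fun x : E3 =>
      f ((cNorm c x)⁻¹ • x) * expTwoPiI (-inner ℝ ((cNorm c x)⁻¹ • x) ξ) := by
  have hm := measurable_cNorm c
  have h : Measurable fun x : E3 => (cNorm c x)⁻¹ • x := by fun_prop
  exact (hf.continuous.measurable.comp h).mul ((continuous_expTwoPiI_inner ξ).measurable.comp h)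

lemma IsSphereSymbol.integral_eq (hf : IsSphereSymbol c A f) (ξ : E3) :
    ∫ w, f w * expTwoPiI (-inner ℝ w ξ) ∂(cSphereMeasure c) =
      3 * ∫ x in cBall c, f ((cNorm c x)⁻¹ • x) *
        expTwoPiI (-inner ℝ ((cNorm c x)⁻¹ • x) ξ) := by
  have hm := measurable_cNorm c
  have h : Measurable fun x : E3 => (cNorm c x)⁻¹ • x := by fun_prop
  have hG : Continuous fun w : E3 => f w * expTwoPiI (-inner ℝ w ξ) :=
    hf.continuous.mul (continuous_expTwoPiI_inner ξ)
  rw [cSphereMeasure, integral_smul_measure, integral_map h.aemeasurable hG.aestronglyMeasurable]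
  rw [ENNReal.toReal_ofNat, Complex.real_smul]
  norm_cast

/-- The symmetry preserves volume and `cNorm`, maps symbols to symbols with the same constant, and
passes by adjunction to a frequency of the same norm. -/
lemma IsSphereSymbol.norm_setIntegral_signedCone_le (hc1 : 1 < c) (hc2 : c < 2)
    (hf : IsSphereSymbol c A f) (i : (Fin 3 → Bool) × Fin 3) (ξ : E3) :
    ‖∫ x in signedCone i ∩ cBall c, f ((cNorm c x)⁻¹ • x) *
      expTwoPiI (-inner ℝ ((cNorm c x)⁻¹ • x) ξ)‖ * ‖ξ‖ ≤ chartConst c * A := by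
  have h := (hf.comp_signedSwap i).norm_setIntegral_chartCone_le hc1 hc2 ((signedSwap i).symm ξ)
  rw [LinearIsometryEquiv.norm_map] at h
  rw [← (signedSwap i).measurePreserving.setIntegral_preimage_emb
    (signedSwap i).toHomeomorph.measurableEmbedding]
  have hpre : signedSwap i ⁻¹' (signedCone i ∩ cBall c) = chartCone ∩ cBall c := by
    ext x
    simp [signedCone, cBall, cNorm_signedSwap]
  rw [hpre]
  convert h using 3
  congr 1
  ext x
  rw [cNorm_signedSwap, ← map_smul, LinearIsometryEquiv.inner_map_eq_flip]

theorem IsSphereSymbol.norm_integral_mul_le (hc1 : 1 < c) (hc2 : c < 2)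
    (hf : IsSphereSymbol c A f) (ξ : E3) :
    ‖∫ w, f w * expTwoPiI (-inner ℝ w ξ) ∂(cSphereMeasure c)‖ * ‖ξ‖ ≤
      72 * chartConst c * A := by
  have hc : 0 < c := by linarith
  set G : E3 → ℂ := fun x => f ((cNorm c x)⁻¹ • x) *
    expTwoPiI (-inner ℝ ((cNorm c x)⁻¹ • x) ξ) with hG
  have hi : IntegrableOn G (cBall c) :=
    Measure.integrableOn_of_bounded (volume_cBall_lt_top hc).ne
      (hf.measurable_integrand ξ).aestronglyMeasurable (ae_restrict_of_ae (hf.ae_norm_le hc ξ))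
  have hsplit : ∫ x in cBall c, G x = ∑ i, ∫ x in signedCone i ∩ cBall c, G x := by
    rw [← integral_iUnion_fintype
      (fun i => (measurableSet_signedCone i).inter (measurableSet_cBall c))
      (fun i j hij => (pairwise_disjoint_signedCone hij).mono inter_subset_left inter_subset_left)
      (fun i => hi.mono_set inter_subset_right), ← iUnion_inter]
    refine setIntegral_congr_set ?_
    filter_upwards [ae_mem_iUnion_signedCone] with x hx
    exact propext ⟨fun h => ⟨hx, h⟩, fun h => h.2⟩
  rw [hf.integral_eq, norm_mul, hsplit]
  -- There are 2³·3 = 24 cones; the factor 3 in μ_c then gives 72.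
  have hsum : ‖∑ i, ∫ x in signedCone i ∩ cBall c, G x‖ * ‖ξ‖ ≤ 24 * (chartConst c * A) := by
    calc _ ≤ (∑ i, ‖∫ x in signedCone i ∩ cBall c, G x‖) * ‖ξ‖ := by
          gcongr; exact norm_sum_le _ _
      _ = ∑ i, ‖∫ x in signedCone i ∩ cBall c, G x‖ * ‖ξ‖ := Finset.sum_mul _ _ _
      _ ≤ ∑ _i : (Fin 3 → Bool) × Fin 3, chartConst c * A :=
          Finset.sum_le_sum fun i _ => hf.norm_setIntegral_signedCone_le hc1 hc2 i ξ
      _ = 24 * (chartConst c * A) := by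
          rw [Finset.sum_const, nsmul_eq_mul]; norm_num
  calc _ = 3 * (‖∑ i, ∫ x in signedCone i ∩ cBall c, G x‖ * ‖ξ‖) := by
        rw [Complex.norm_ofNat]; ring
    _ ≤ _ := by linarith

/-- The decay constant. -/
noncomputable def decayConst (c : ℝ) : ℝ := 3 * volume.real (cBall c) + 72 * chartConst c

theorem IsSphereSymbol.norm_integral_le (hc1 : 1 < c) (hc2 : c < 2)
    (hf : IsSphereSymbol c A f) (ξ : E3) :
    ‖∫ w, f w * expTwoPiI (-inner ℝ w ξ) ∂(cSphereMeasure c)‖ ≤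
      decayConst c * A * (1 + ‖ξ‖)⁻¹ := by
  have hc : 0 < c := by linarith
  have h1 := hf.norm_integral_mul_le hc1 hc2 ξ
  have h2 : ‖∫ w, f w * expTwoPiI (-inner ℝ w ξ) ∂(cSphereMeasure c)‖ ≤
      3 * (A * volume.real (cBall c)) := by
    rw [hf.integral_eq, norm_mul, Complex.norm_ofNat]
    gcongr
    exact norm_setIntegral_le_of_norm_le_const_ae (volume_cBall_lt_top hc)
      (ae_restrict_of_ae (hf.ae_norm_le hc ξ))
  -- Multiplied by 1 + ‖ξ‖, the integral is bounded by the trivial estimate for the 1 plus the decay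
  -- estimate for ‖ξ‖.
  rw [← div_eq_mul_inv, le_div_iff₀ (by positivity), decayConst]
  linarith

end

/-! ### The symbols used in the two statements -/

lemma isOpen_offCoordinatePlanes : IsOpen offCoordinatePlanes := by
  have : offCoordinatePlanes = ⋂ j : Fin 3, {x : E3 | x j ≠ 0} := by
    ext x; simp [offCoordinatePlanes]
  rw [this]
  exact isOpen_iInter_of_finite fun j => isOpen_ne_fun (by fun_prop) continuous_const

lemma sum_smul_single (v : E3) : v = ∑ j, v j • EuclideanSpace.single j (1 : ℝ) := by
  ext k
  fin_cases k <;> simp [Fin.sum_univ_three]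

lemma multiDeriv_zero (f : E3 → ℂ) : multiDeriv 0 f = f := rfl

lemma multiDeriv_single (j : Fin 3) (f : E3 → ℂ) :
    multiDeriv (Pi.single j 1) f = partialDeriv j f := by
  fin_cases j <;> rfl

/-- Only the derivatives of order at most one in each variable separately are needed. -/
lemma isSphereSymbol_of_multiDeriv {c : ℝ} {A : (Fin 3 → ℕ) → ℝ} {f : E3 → ℂ}
    (hf : Continuous f) (hd : ContDiffOn ℝ ∞ f offCoordinatePlanes)
    (hA : ∀ β : Fin 3 → ℕ, ∀ x ∈ offCoordinatePlanes,
      ‖multiDeriv β f x‖ ≤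
        A β * ∏ j, |x j| ^ (-(β j : ℝ) + (c - 1) * (if 1 ≤ β j then 1 else 0))) :
    IsSphereSymbol c (|A 0| + ∑ j, |A (Pi.single j 1)|) f := by
  have hdiff : ∀ x ∈ offCoordinatePlanes, DifferentiableAt ℝ f x := fun x hx =>
    (hd.differentiableOn (by simp)).differentiableAt (isOpen_offCoordinatePlanes.mem_nhds hx)
  have hnn : 0 ≤ ∑ j : Fin 3, |A (Pi.single j 1)| := Finset.sum_nonneg fun _ _ => abs_nonneg _
  refine ⟨hf, hdiff, fun x hx _ => ?_, fun x hx _ v => ?_⟩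
  · have h := hA 0 x hx
    simp only [multiDeriv_zero, Pi.zero_apply, CharP.cast_eq_zero, neg_zero, nonpos_iff_eq_zero,
      one_ne_zero, if_false, mul_zero, add_zero, Real.rpow_zero, Finset.prod_const_one,
      mul_one] at h
    linarith [le_abs_self (A 0)]
  · set M := |A 0| + ∑ j, |A (Pi.single j 1)| with hM
    have hj : ∀ j, ‖fderiv ℝ f x (EuclideanSpace.single j 1)‖ ≤ M * |x j| ^ (c - 2) := fun j => by
      have h := hA (Pi.single j 1) x hx
      rw [multiDeriv_single, partialDeriv, (hdiff x hx).lineDeriv_eq_fderiv,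
        Finset.prod_eq_single j] at h
      · simp only [Pi.single_eq_same, Nat.cast_one, le_refl, if_true, mul_one] at h
        rw [show -1 + (c - 1) = c - 2 by ring] at h
        refine h.trans ?_
        gcongr
        have := Finset.single_le_sum (f := fun j => |A (Pi.single j 1)|)
          (fun _ _ => abs_nonneg _) (Finset.mem_univ j)
        linarith [le_abs_self (A (Pi.single j 1)), abs_nonneg (A 0)]
      · intro k _ hk
        simp [hk]
      · simp
    calc ‖fderiv ℝ f x v‖ = ‖∑ j, v j • fderiv ℝ f x (EuclideanSpace.single j 1)‖ := by
          conv_lhs => rw [sum_smul_single v, map_sum]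
          simp_rw [map_smul]
      _ ≤ ∑ j, ‖v j • fderiv ℝ f x (EuclideanSpace.single j 1)‖ := norm_sum_le _ _
      _ ≤ ∑ j, M * (|v j| * |x j| ^ (c - 2)) := by
          refine Finset.sum_le_sum fun j _ => ?_
          rw [norm_smul, Real.norm_eq_abs, mul_left_comm]
          exact mul_le_mul_of_nonneg_left (hj j) (abs_nonneg _)
      _ = M * ∑ j, |v j| * |x j| ^ (c - 2) := (Finset.mul_sum _ _ _).symm

lemma isSphereSymbol_one (c : ℝ) : IsSphereSymbol c 1 (fun _ => 1) where
  continuous := continuous_const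
  differentiableAt _ _ := differentiableAt_const _
  norm_le _ _ _ := by simp
  norm_fderiv_le x _ _ v := by
    simp only [fderiv_fun_const, Pi.zero_apply, zero_apply, norm_zero]
    positivity

/-- This is the factor produced by differentiating e(-w·ξ) in ξ_j. Its derivative is bounded, which
is enough because |x_j|^(c-2) ≥ 1 on the unit cube. -/
lemma isSphereSymbol_coord {c : ℝ} (hc2 : c < 2) (j : Fin 3) :
    IsSphereSymbol c (2 * Real.pi) (fun w => -(2 * Real.pi * Complex.I) * (w j : ℂ)) := by
  have hd : ∀ x : E3, HasFDerivAt (fun w : E3 => -(2 * Real.pi * Complex.I) * (w j : ℂ))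
      ((-(2 * Real.pi * Complex.I)) • Complex.ofRealCLM.comp (EuclideanSpace.proj j)) x := fun x =>
    ((Complex.ofRealCLM.comp (EuclideanSpace.proj j : E3 →L[ℝ] ℝ)).hasFDerivAt).const_mul _
  have hn : ‖-(2 * (Real.pi : ℂ) * Complex.I)‖ = 2 * Real.pi := by
    simp [abs_of_pos Real.pi_pos]
  refine ⟨?_, fun x _ => (hd x).differentiableAt, fun x _ h => ?_, fun x hx h v => ?_⟩
  · fun_prop
  · rw [norm_mul, hn, Complex.norm_real, Real.norm_eq_abs]
    exact mul_le_of_le_one_right Real.two_pi_pos.le (h j)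
  · have e : ((-(2 * (Real.pi : ℂ) * Complex.I)) •
        Complex.ofRealCLM.comp (EuclideanSpace.proj j : E3 →L[ℝ] ℝ)) v =
        -(2 * Real.pi * Complex.I) * (v j : ℂ) := rfl
    rw [(hd x).fderiv, e, norm_mul, hn, Complex.norm_real, Real.norm_eq_abs]
    gcongr
    have h1 : 1 ≤ |x j| ^ (c - 2) :=
      Real.one_le_rpow_of_pos_of_le_one_of_nonpos (abs_pos.2 (hx j)) (h j) (by linarith)
    refine (le_mul_of_one_le_right (abs_nonneg _) h1).trans ?_
    exact Finset.single_le_sum (f := fun j => |v j| * |x j| ^ (c - 2))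
      (fun _ _ => by positivity) (Finset.mem_univ j)

/-! ### Differentiability of the Fourier transform and conclusion -/

lemma isFiniteMeasure_cSphereMeasure {c : ℝ} (hc : 0 < c) : IsFiniteMeasure (cSphereMeasure c) := by
  have : Fact (volume (cBall c) < ⊤) := ⟨volume_cBall_lt_top hc⟩
  have : IsFiniteMeasure (volume.restrict {x | 0 < cNorm c x ∧ cNorm c x < 1}) :=
    inferInstanceAs (IsFiniteMeasure (volume.restrict (cBall c)))
  have : IsFiniteMeasure ((volume.restrict {x | 0 < cNorm c x ∧ cNorm c x < 1}).map
    (fun x => (cNorm c x)⁻¹ • x)) := inferInstance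
  unfold cSphereMeasure
  exact Measure.smul_finite _ (by norm_num)

lemma ae_norm_le_cSphereMeasure {c : ℝ} (hc : 0 < c) : ∀ᵐ w ∂(cSphereMeasure c), ‖w‖ ≤ 3 := by
  filter_upwards [measure_eq_zero_iff_ae_notMem.1 (cSphereMeasure_compl_cSphere hc)] with w hw
  have hw1 : cNorm c w = 1 := not_not.1 hw
  have h := fun j => (abs_apply_le_cNorm hc w j).trans hw1.le
  linarith [norm_le_sum_abs w, h 0, h 1, h 2]

lemma fourierChar_smul (t : ℝ) (z : ℂ) : Real.fourierChar t • z = expTwoPiI t * z := by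
  rw [Circle.smul_def, Real.fourierChar_apply, smul_eq_mul, expTwoPiI]
  congr 2
  push_cast
  ring

/-- Differentiation under the integral sign, legitimate because μ_c is finite and carried by a
bounded set. It expresses the partial derivatives as integrals to which the decay estimate applies.
-/
lemma hasFDerivAt_cSphereFourier {c : ℝ} (hc : 0 < c) (ξ : E3) :
    ∃ D : E3 →L[ℝ] ℂ, HasFDerivAt (cSphereFourier c) D ξ ∧ ∀ j, D (EuclideanSpace.single j 1) =
      ∫ w, (-(2 * Real.pi * Complex.I) * (w j : ℂ)) * expTwoPiI (-inner ℝ w ξ)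
        ∂(cSphereMeasure c) := by
  have := isFiniteMeasure_cSphereMeasure hc
  have hae := ae_norm_le_cSphereMeasure hc
  have h1 : Integrable (fun _ : E3 => (1 : ℂ)) (cSphereMeasure c) := integrable_const _
  have h2 : Integrable (fun w : E3 => ‖w‖ * ‖(1 : ℂ)‖) (cSphereMeasure c) := by
    refine Integrable.of_bound (by fun_prop) 3 ?_
    filter_upwards [hae] with w hw
    simpa using hw
  have hD := VectorFourier.hasFDerivAt_fourierIntegral (innerSL ℝ : E3 →L[ℝ] E3 →L[ℝ] ℝ) h1 h2 ξ
  have hfun : VectorFourier.fourierIntegral Real.fourierChar (cSphereMeasure c)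
      (ContinuousLinearMap.toLinearMap₁₂ (innerSL ℝ : E3 →L[ℝ] E3 →L[ℝ] ℝ)) (fun _ => (1 : ℂ)) =
      cSphereFourier c := by
    ext η
    unfold VectorFourier.fourierIntegral cSphereFourier
    refine integral_congr_ae (Eventually.of_forall fun w => ?_)
    simp only [fourierChar_smul, mul_one]
    rfl
  rw [hfun] at hD
  refine ⟨_, hD, fun j => ?_⟩
  unfold VectorFourier.fourierIntegral
  rw [ContinuousLinearMap.integral_apply]
  · refine integral_congr_ae (Eventually.of_forall fun w => ?_)
    have e : (innerSL ℝ w) (EuclideanSpace.single j (1 : ℝ)) = w j := by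
      simp [innerSL_apply_apply, EuclideanSpace.inner_single_right]
    change Real.fourierChar (-inner ℝ w ξ) •
      (VectorFourier.fourierSMulRight (innerSL ℝ : E3 →L[ℝ] E3 →L[ℝ] ℝ) (fun _ : E3 => (1 : ℂ)) w
        (EuclideanSpace.single j 1)) = _
    rw [fourierChar_smul, VectorFourier.fourierSMulRight_apply, e, mul_comm, smul_eq_mul,
      Complex.real_smul, mul_one]
  · have hc1 : Continuous fun p : E3 × E3 =>
        (ContinuousLinearMap.toLinearMap₁₂ (innerSL ℝ : E3 →L[ℝ] E3 →L[ℝ] ℝ)) p.1 p.2 :=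
      continuous_inner
    refine (VectorFourier.fourierIntegral_convergent_iff Real.continuous_fourierChar hc1 ξ).2 ?_
    refine Integrable.of_bound
      h1.aestronglyMeasurable.fourierSMulRight
      (2 * Real.pi * ‖(innerSL ℝ : E3 →L[ℝ] E3 →L[ℝ] ℝ)‖ * 3) ?_
    filter_upwards [hae] with w hw
    refine (VectorFourier.norm_fourierSMulRight_le _ _ _).trans ?_
    rw [norm_one, mul_one]
    gcongr

theorem lemma5p2 (c : ℝ) (hc1 : 1 < c) (hc2 : c < 2) :
    (∀ A : (Fin 3 → ℕ) → ℝ, ∃ C : ℝ, ∀ f : EuclideanSpace ℝ (Fin 3) → ℂ,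
      Continuous f → ContDiffOn ℝ ∞ f offCoordinatePlanes →
      (∀ β : Fin 3 → ℕ, ∀ x ∈ offCoordinatePlanes,
        ‖multiDeriv β f x‖ ≤
          A β * ∏ j, |x j| ^ (-(β j : ℝ) + (c - 1) * (if 1 ≤ β j then 1 else 0))) →
      ∀ ξ : EuclideanSpace ℝ (Fin 3),
        ‖∫ w, f w * expTwoPiI (-inner ℝ w ξ) ∂(cSphereMeasure c)‖ ≤ C * (1 + ‖ξ‖)⁻¹) ∧
    (Differentiable ℝ (cSphereFourier c) ∧
      ∃ C : ℝ, ∀ ξ : EuclideanSpace ℝ (Fin 3),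
        ‖cSphereFourier c ξ‖ + ‖complexGradient (cSphereFourier c) ξ‖ ≤ C * (1 + ‖ξ‖)⁻¹) := by
  have hc : 0 < c := by linarith
  refine ⟨fun A => ⟨_, fun f hf hd hA ξ =>
    (isSphereSymbol_of_multiDeriv hf hd hA).norm_integral_le hc1 hc2 ξ⟩, fun ξ => ?_,
    decayConst c * 1 + 3 * (decayConst c * (2 * Real.pi)), fun ξ => ?_⟩
  · obtain ⟨D, hD, -⟩ := hasFDerivAt_cSphereFourier hc ξ
    exact hD.differentiableAt
  · obtain ⟨D, hD, hDj⟩ := hasFDerivAt_cSphereFourier hc ξ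
    have h0 := (isSphereSymbol_one c).norm_integral_le hc1 hc2 ξ
    simp only [one_mul] at h0
    have hj : ∀ j, ‖partialDeriv j (cSphereFourier c) ξ‖ ≤
        decayConst c * (2 * Real.pi) * (1 + ‖ξ‖)⁻¹ := fun j => by
      rw [partialDeriv, hD.differentiableAt.lineDeriv_eq_fderiv, hD.fderiv, hDj]
      exact (isSphereSymbol_coord hc2 j).norm_integral_le hc1 hc2 ξ
    -- The Hermitian norm is at most the sum of the moduli, which accounts for the 3 in the
    -- constant.
    have hg : ‖complexGradient (cSphereFourier c) ξ‖ ≤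
        ∑ j, ‖partialDeriv j (cSphereFourier c) ξ‖ := by
      rw [EuclideanSpace.norm_eq]
      refine Real.sqrt_le_iff.2 ⟨by positivity, ?_⟩
      exact Finset.sum_sq_le_sq_sum_of_nonneg fun j _ => norm_nonneg _
    rw [Fin.sum_univ_three] at hg
    have : ‖cSphereFourier c ξ‖ ≤ decayConst c * 1 * (1 + ‖ξ‖)⁻¹ := h0
    rw [add_mul]
    linarith [hj 0, hj 1, hj 2]
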